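/- **Conventions.** A function $F:\subseteq\mathbb N^{\mathbb N}\to\mathbb N^{\mathbb N}$ is computable if some Turing machine with one-way output computes $F(p)$ from $p$ for all $p\in\mathrm{dom}(F)$. A represented space is a set $X$ with a surjective partial map $\delta_X:\subseteq\mathbb N^{\mathbb N}\to X$; products carry the representation $\delta_{X\times Y}\langle p,q\rangle=(\delta_X(p),\delta_Y(q))$, where $\langle p,q\rangle(2k)=p(k)$ and $\langle p,q\rangle(2k+1)=q(k)$. A partial multi-valued function $f:\subseteq X\rightrightarrows Y$ assigns to each $x$ a set $f(x)\subseteq Y$, with $\mathrm{dom}(f)=\{x:f(x)\neq\emptyset\}$; $(f\times g)(x,z)=f(x)\times g(z)$; and $(g\circ f)(x)=\bigcup_{y\in f(x)}g(y)$ with $\mathrm{dom}(g\circ f)=\{x\in\mathrm{dom}(f):f(x)\subseteq\mathrm{dom}(g)\}$. A realizer of $f$, written $F\vdash f$, is an $F:\subseteq\mathbb N^{\mathbb N}\to\mathbb N^{\mathbb N}$ with $\delta_Y(F(p))\in f(\delta_X(p))$ whenever $\delta_X(p)\in\mathrm{dom}(f)$. One writes $f\le_W g$ (respectively $f\le_{sW}g$)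 if there are computable $H,K:\subseteq\mathbb N^{\mathbb N}\to\mathbb N^{\mathbb N}$ such that $H\langle\mathrm{id},GK\rangle\vdash f$ (respectively $HGK\vdash f$) for all $G\vdash g$; $\equiv_W$ and $\equiv_{sW}$ are the induced equivalences. The compositional product $f*g$ is the Weihrauch degree $\max\{f_0\circ g_0: f_0\le_W f,\ g_0\le_W g\}$, the maximum with respect to $\le_W$ over all composable $f_0,g_0$ on represented spaces. Let $\mathbb N$ carry the counting measure, $2^{\mathbb N}$ the uniform measure and $\mathbb N\times 2^{\mathbb N}$ the product measure, and let closed sets be represented by negative information (a name enumerates basic open sets exhausting the complement). $\mathsf C_{\mathbb N}$ maps each non-empty $A\subseteq\mathbb N$ to the set $A$ of its possible values; for $R\in\{2^{\mathbb N},\mathbb N\times2^{\mathbb N}\}$, $\mathsf{PC}_R$ maps each closed $A\subseteq R$ of positive (possibly infinite) measure to the set $A$ of its possible values. A multi-valued function $f:\subseteq X\rightrightarrows Y$ on represented spaces is *computable with finitely many mind changes* if it has a realizer computed by a machine that may revise its output, but does so only finitely often on each input in the domain of the realizer. It is *Las Vegas computable over $R\subseteq\mathbb N^{\mathbb N}$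 with measure in $I$* if there are computable $F_1,F_2:\subseteq\mathbb N^{\mathbb N}\to\mathbb N^{\mathbb N}$ such that for all $p$ with $\delta_X(p)\in\mathrm{dom}(f)$: $F_2\langle p,r\rangle$ is defined for all $r\in R$; the set $S_p=\{r\in R:F_2\langle p,r\rangle=000\ldots\}$ is non-empty and its measure lies in $I$; and $\delta_Y(F_1\langle p,r\rangle)\in f(\delta_X(p))$ for all $r\in S_p$. It is *Las Vegas computable* if this holds for $R=2^{\mathbb N}$, $I=(0,1]$, and *Las Vegas computable with finitely many mind changes* if this holds for $R=\mathbb N\times2^{\mathbb N}$ (where $(k,x)$ is identified with the sequence $k\,x(0)\,x(1)\ldots$), $I=(0,\infty]$. **Statement.** The compositional products below exist, and $$\mathsf{PC}_{2^{\mathbb N}}\times\mathsf C_{\mathbb N}\equiv_{sW}\mathsf C_{\mathbb N}\times\mathsf{PC}_{2^{\mathbb N}}\equiv_W\mathsf{PC}_{2^{\mathbb N}}*\mathsf C_{\mathbb N}\equiv_W\mathsf C_{\mathbb N}*\mathsf{PC}_{2^{\mathbb N}}\equiv_W\mathsf{PC}_{\mathbb N\times2^{\mathbb N}}.$$ Moreover,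 for every multi-valued function $f$ on represented spaces the following are equivalent: 1. $f$ is Las Vegas computable with finitely many mind changes; 2. $f=g\circ h$ for some Las Vegas computable $g$ and some $h$ that is computable with finitely many mind changes; 3. $f=g\circ h$ for some $g$ that is computable with finitely many mind changes and some Las Vegas computable $h$. -/

import Mathlib

open MeasureTheory TopologicalSpace
open scoped ENNReal

universe u v w

namespace Weihrauch

noncomputable section

/-! ### Baire space and computable functions on it -/

/-- Baire space `ℕ^ℕ`. -/
abbrev Baire : Type := ℕ → ℕ

/-- Cantor space `2^ℕ`. -/
abbrev Cantor : Type := ℕ → Bool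

/-- The prefix of length `k` of an infinite sequence. -/
def initSeg {α : Type*} (p : ℕ → α) (k : ℕ) : List α := (List.range k).map p

/-- The pairing `⟨p, q⟩` of sequences: `⟨p, q⟩(2k) = p(k)`, `⟨p, q⟩(2k+1) = q(k)`. -/
def pair (p q : Baire) : Baire := fun n => if n % 2 = 0 then p (n / 2) else q (n / 2)

/-- The first component of a paired sequence. -/
def unpairFst (r : Baire) : Baire := fun n => r (2 * n)

/-- The second component of a paired sequence. -/
def unpairSnd (r : Baire) : Baire := fun n => r (2 * n + 1)

theorem unpairFst_pair (p q : Baire) : unpairFst (pair p q) = p := by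
  funext n
  simp [unpairFst, pair]

theorem unpairSnd_pair (p q : Baire) : unpairSnd (pair p q) = q := by
  funext n
  have h1 : (2 * n + 1) % 2 = 1 := by omega
  have h2 : (2 * n + 1) / 2 = n := by omega
  simp [unpairSnd, pair, h1, h2]

/-- A partial function `F :⊆ ℕ^ℕ → ℕ^ℕ` is computable if a machine with one-way output computes
`F(p)` from `p` for every `p ∈ dom(F)`: there is a computable function `φ` on finite words, monotone
for the prefix order, such that for `p ∈ dom(F)` the words `φ(p|k)` are prefixes of `F(p)` of
unbounded length. (Nothing is required of the machine outside `dom(F)`.) -/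
def ComputableBaire (F : Baire →. Baire) : Prop :=
  ∃ φ : List ℕ → List ℕ, Computable φ ∧ (∀ σ τ, σ <+: τ → φ σ <+: φ τ) ∧
    ∀ p : Baire, ∀ q ∈ F p,
      (∀ k, φ (initSeg p k) = initSeg q (φ (initSeg p k)).length) ∧
      (∀ n, ∃ k, n ≤ (φ (initSeg p k)).length)

/-- A partial function `F :⊆ ℕ^ℕ → ℕ^ℕ` is computable with finitely many mind changes if a machine
that may revise its output computes it with finitely many revisions: `φ(p|k)` is the content of the
output tape at stage `k`; for `p ∈ dom(F)` there are only finitely many stages at which the content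
is not just extended (the mind changes), and the content converges to `F(p)`. -/
def FiniteMindChangeBaire (F : Baire →. Baire) : Prop :=
  ∃ φ : List ℕ → List ℕ, Computable φ ∧
    ∀ p : Baire, ∀ q ∈ F p,
      {k | ¬ φ (initSeg p k) <+: φ (initSeg p (k + 1))}.Finite ∧
      (∀ n, ∃ k₀, ∀ k ≥ k₀, (φ (initSeg p k))[n]? = some (q n))

/-! ### Represented spaces and multi-valued functions -/

/-- A representation of `X`: a surjective partial map from Baire space to `X`. -/
class Represented (X : Type u) where
  δ : Baire →. X
  surj : ∀ x : X, ∃ p : Baire, x ∈ δ p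

/-- A partial multi-valued function `f :⊆ X ⇉ Y`; its domain consists of the `x` with `f x ≠ ∅`. -/
abbrev MultiFun (X : Type u) (Y : Type v) : Type (max u v) := X → Set Y

namespace MultiFun

/-- The domain of a multi-valued function. -/
def dom {X : Type u} {Y : Type v} (f : MultiFun X Y) : Set X := {x | (f x).Nonempty}

/-- The composition `g ∘ f`, with domain `{x ∈ dom f | f x ⊆ dom g}`. -/
def comp {X : Type u} {Y : Type v} {Z : Type w} (g : MultiFun Y Z) (f : MultiFun X Y) :
    MultiFun X Z :=
  fun x => {z | f x ⊆ g.dom ∧ ∃ y ∈ f x, z ∈ g y}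

/-- The product `f × g`. -/
def prod {X Y Z W : Type*} (f : MultiFun X Y) (g : MultiFun Z W) : MultiFun (X × Z) (Y × W) :=
  fun a => f a.1 ×ˢ g a.2

end MultiFun

/-- `F ⊢ f`: `F` is a realizer of `f`. -/
def Realizes {X Y : Type*} [Represented X] [Represented Y] (F : Baire →. Baire)
    (f : MultiFun X Y) : Prop :=
  ∀ p : Baire, ∀ x ∈ Represented.δ (X := X) p, x ∈ f.dom →
    ∃ q ∈ F p, ∃ y ∈ Represented.δ (X := Y) q, y ∈ f x

/-- `f` is computable with finitely many mind changes: it has such a realizer. -/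
def FiniteMindChangeComputable {X Y : Type*} [Represented X] [Represented Y]
    (f : MultiFun X Y) : Prop :=
  ∃ F : Baire →. Baire, FiniteMindChangeBaire F ∧ Realizes F f

/-! ### Weihrauch reducibility -/

/-- Weihrauch reducibility `f ≤_W g`: for some computable `K`, `H`, the function `H⟨id, GK⟩`
realizes `f` for every realizer `G` of `g`. -/
def WReducible {X Y Z W : Type*} [Represented X] [Represented Y] [Represented Z] [Represented W]
    (f : MultiFun X Y) (g : MultiFun Z W) : Prop :=
  ∃ K H : Baire →. Baire, ComputableBaire K ∧ ComputableBaire H ∧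
    ∀ G : Baire →. Baire, Realizes G g →
      Realizes (fun p => (K p).bind fun s => (G s).bind fun t => H (pair p t)) f

/-- Strong Weihrauch reducibility `f ≤_sW g`: for some computable `K`, `H`, the function `HGK`
realizes `f` for every realizer `G` of `g`. -/
def SWReducible {X Y Z W : Type*} [Represented X] [Represented Y] [Represented Z] [Represented W]
    (f : MultiFun X Y) (g : MultiFun Z W) : Prop :=
  ∃ K H : Baire →. Baire, ComputableBaire K ∧ ComputableBaire H ∧
    ∀ G : Baire →. Baire, Realizes G g →
      Realizes (fun p => (K p).bind fun s => (G s).bind fun t => H t) f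

/-- Weihrauch equivalence `f ≡_W g`. -/
def WEquiv {X Y Z W : Type*} [Represented X] [Represented Y] [Represented Z] [Represented W]
    (f : MultiFun X Y) (g : MultiFun Z W) : Prop :=
  WReducible f g ∧ WReducible g f

/-- Strong Weihrauch equivalence `f ≡_sW g`. -/
def SWEquiv {X Y Z W : Type*} [Represented X] [Represented Y] [Represented Z] [Represented W]
    (f : MultiFun X Y) (g : MultiFun Z W) : Prop :=
  SWReducible f g ∧ SWReducible g f

/-- `h ≡_W f * g`. The compositional product `f * g` is the Weihrauch degree
`max {f₀ ∘ g₀ : f₀ ≤_W f and g₀ ≤_W g}`, over all composable `f₀`, `g₀` on represented spaces.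
So `h` belongs to this degree iff `h` is equivalent to one of these `f₀ ∘ g₀` and all of them are
reducible to `h`. -/
def IsCompositionalProduct {A B C D E G : Type*}
    [Represented A] [Represented B] [Represented C] [Represented D] [Represented E] [Represented G]
    (f : MultiFun A B) (g : MultiFun C D) (h : MultiFun E G) : Prop :=
  (∃ (X Y Z : Type u) (_ : Represented X) (_ : Represented Y) (_ : Represented Z)
      (f₀ : MultiFun Y Z) (g₀ : MultiFun X Y),
      WReducible f₀ f ∧ WReducible g₀ g ∧ WEquiv h (f₀.comp g₀)) ∧
  (∀ (X Y Z : Type u) [Represented X] [Represented Y] [Represented Z]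
      (f₀ : MultiFun Y Z) (g₀ : MultiFun X Y),
      WReducible f₀ f → WReducible g₀ g → WReducible (f₀.comp g₀) h)

/-! ### The spaces `ℕ`, `2^ℕ`, products, and hyperspaces of closed sets -/

/-- `2^ℕ` as a subset of `ℕ^ℕ`. -/
def cantorToBaire (x : Cantor) : Baire := fun n => (x n).toNat

/-- `ℕ × 2^ℕ` as a subset of `ℕ^ℕ`: the pair `(k, x)` is the sequence `k x(0) x(1) x(2) …`. -/
def natCantorToBaire (a : ℕ × Cantor) : Baire
  | 0 => a.1
  | n + 1 => (a.2 n).toNat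

/-- The representation of `ℕ`: `p` is a name of `p(0)`. -/
instance instRepresentedNat : Represented ℕ where
  δ := fun p => Part.some (p 0)
  surj := fun n => ⟨fun _ => n, by simp⟩

/-- The representation of `2^ℕ`: `x` is its own only name. -/
instance instRepresentedCantor : Represented Cantor where
  δ := fun p => ⟨∀ n, p n < 2, fun _ n => decide (p n = 1)⟩
  surj := fun x => ⟨cantorToBaire x, by
    refine ⟨fun n => ?_, ?_⟩
    · cases h : x n <;> simp [cantorToBaire, h]
    · funext n
      cases h : x n <;> simp [cantorToBaire, h]⟩

/-- The product representation: `⟨p, q⟩` is a name of `(x, y)` iff `p`, `q` are names of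
`x`, `y`. -/
instance instRepresentedProd {X : Type u} {Y : Type v} [Represented X] [Represented Y] :
    Represented (X × Y) where
  δ := fun r => (Represented.δ (X := X) (unpairFst r)).bind fun x =>
    (Represented.δ (X := Y) (unpairSnd r)).map fun y => (x, y)
  surj := by
    rintro ⟨x, y⟩
    obtain ⟨p, hp⟩ := Represented.surj x
    obtain ⟨q, hq⟩ := Represented.surj y
    refine ⟨pair p q, ?_⟩
    rw [unpairFst_pair, unpairSnd_pair]
    exact Part.mem_bind_iff.2 ⟨x, hp, (Part.mem_map_iff _).2 ⟨y, hq, rfl⟩⟩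

/-- A numbered countable basis of open sets ("rational balls"). -/
class NumberedBasis (X : Type u) [TopologicalSpace X] where
  ball : ℕ → Set X
  isBasis : IsTopologicalBasis (Set.range ball)

/-- The balls of `ℕ`: the singletons. -/
instance instNumberedBasisNat : NumberedBasis ℕ where
  ball := fun n => {n}
  isBasis := by
    refine isTopologicalBasis_of_isOpen_of_nhds (fun _ _ => isOpen_discrete _) ?_
    intro a s ha _
    exact ⟨{a}, ⟨a, rfl⟩, rfl, by simpa using ha⟩

/-- The cylinder `w 2^ℕ` where `w` is the binary word with code `c`
(empty if `c` is not a code). -/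
def cantorBall (c : ℕ) : Set Cantor :=
  {x | ∃ w ∈ (Encodable.decode c : Option (List Bool)), initSeg x w.length = w}

theorem cantorBall_encode (x : Cantor) (n : ℕ) :
    cantorBall (Encodable.encode (initSeg x n)) = PiNat.cylinder x n := by
  ext y
  simp [cantorBall, PiNat.cylinder, initSeg]

/-- The balls of `2^ℕ`: the cylinders. -/
instance instNumberedBasisCantor : NumberedBasis Cantor where
  ball := cantorBall
  isBasis := by
    refine isTopologicalBasis_of_isOpen_of_nhds ?_ ?_
    · rintro _ ⟨c, rfl⟩
      rw [isOpen_iff_forall_mem_open]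
      rintro x ⟨w, hw, hx⟩
      refine ⟨PiNat.cylinder x w.length, ?_, PiNat.isOpen_cylinder _ x w.length,
        PiNat.self_mem_cylinder x _⟩
      rw [← cantorBall_encode, hx]
      rintro y ⟨w', hw', hy⟩
      rw [Encodable.encodek] at hw'
      obtain rfl : w = w' := by simpa using hw'
      exact ⟨w, hw, hy⟩
    · intro x s hx hs
      obtain ⟨_, ⟨y, n, rfl⟩, hxt, hts⟩ :=
        (PiNat.isTopologicalBasis_cylinders (fun _ : ℕ => Bool)).exists_subset_of_mem_open hx hs
      exact ⟨PiNat.cylinder y n, ⟨_, cantorBall_encode y n⟩, hxt, hts⟩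

/-- The balls of a product: the products of balls. -/
instance instNumberedBasisProd {X : Type u} {Y : Type v} [TopologicalSpace X] [TopologicalSpace Y]
    [NumberedBasis X] [NumberedBasis Y] : NumberedBasis (X × Y) where
  ball := fun c => NumberedBasis.ball c.unpair.1 ×ˢ NumberedBasis.ball c.unpair.2
  isBasis := by
    convert (NumberedBasis.isBasis (X := X)).prod (NumberedBasis.isBasis (X := Y)) using 1
    ext s
    constructor
    · rintro ⟨c, rfl⟩
      exact ⟨_, ⟨_, rfl⟩, _, ⟨_, rfl⟩, rfl⟩
    · rintro ⟨_, ⟨a, rfl⟩, _, ⟨b, rfl⟩, rfl⟩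
      exact ⟨Nat.pair a b, by simp⟩

/-- The closed set with negative information `p`: the complement of the union of the balls
enumerated by `p`. The entry `c + 1` enumerates ball number `c`, the entry `0` nothing. -/
def closedOfName {X : Type u} [TopologicalSpace X] [NumberedBasis X] (p : Baire) : Closeds X where
  carrier := (⋃ (i : ℕ) (c : ℕ) (_ : p i = c + 1), NumberedBasis.ball c)ᶜ
  isClosed' := (isOpen_iUnion fun _ => isOpen_iUnion fun c => isOpen_iUnion fun _ =>
    NumberedBasis.isBasis.isOpen ⟨c, rfl⟩).isClosed_compl

/-- The hyperspace `𝒜₋(X)` of closed subsets of `X`, represented by negative information. -/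
instance instRepresentedCloseds {X : Type u} [TopologicalSpace X] [NumberedBasis X] :
    Represented (Closeds X) where
  δ := fun p => Part.some (closedOfName p)
  surj := by
    classical
    intro A
    refine ⟨fun c => if (NumberedBasis.ball c : Set X) ⊆ (A : Set X)ᶜ then c + 1 else 0, ?_⟩
    rw [Part.mem_some_iff]
    refine Closeds.ext (compl_injective ?_)
    change _ = (_ᶜᶜ : Set X)
    rw [compl_compl]
    ext x
    simp only [Set.mem_iUnion]
    constructor
    · intro hx
      obtain ⟨_, ⟨c, rfl⟩, hxc, hc⟩ :=
        NumberedBasis.isBasis.exists_subset_of_mem_open hx A.isClosed.isOpen_compl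
      exact ⟨c, c, by simp [hc], hxc⟩
    · rintro ⟨i, c, h, hxc⟩
      split_ifs at h with hi
      obtain rfl : i = c := by omega
      exact hi hxc

/-! ### Choice, probabilistic choice, Las Vegas computability -/

/-- The uniform measure on `2^ℕ`. -/
def cantorMeasure : Measure Cantor :=
  Measure.infinitePi fun _ : ℕ => (PMF.uniformOfFintype Bool).toMeasure

/-- The measure on `ℕ × 2^ℕ`: the product of the counting measure and the uniform measure. -/
def natCantorMeasure : Measure (ℕ × Cantor) := Measure.count.prod cantorMeasure

/-- Closed choice `C_X :⊆ 𝒜₋(X) ⇉ X, A ↦ A`, defined on the non-empty closed sets. -/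
def closedChoice (X : Type u) [TopologicalSpace X] : MultiFun (Closeds X) X := fun A => A

/-- Probabilistic choice `P_I C_X :⊆ 𝒜₋(X) ⇉ X, A ↦ A`, restricted to the `A` with `μ(A) ∈ I`. -/
def probChoice {X : Type u} [TopologicalSpace X] [MeasurableSpace X] (μ : Measure X)
    (I : Set ℝ≥0∞) : MultiFun (Closeds X) X :=
  fun A => {x | μ A ∈ I ∧ x ∈ A}

/-- `C_ℕ`. -/
def CN : MultiFun (Closeds ℕ) ℕ := closedChoice ℕ

/-- `PC_{2^ℕ}`: choice for closed subsets of Cantor space of measure in `(0,∞]`. -/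
def PCCantor : MultiFun (Closeds Cantor) Cantor := probChoice cantorMeasure (Set.Ioc 0 ⊤)

/-- `PC_{ℕ×2^ℕ}`: choice for closed subsets of `ℕ × 2^ℕ` of measure in `(0,∞]`. -/
def PCNatCantor : MultiFun (Closeds (ℕ × Cantor)) (ℕ × Cantor) :=
  probChoice natCantorMeasure (Set.Ioc 0 ⊤)

/-- `f` is Las Vegas computable over `R` with measure in `I`, where `R` is regarded as a subset of
`ℕ^ℕ` through the injection `ι` and carries the measure `μ`. `F₁` is the computation function and
`F₂` the failure recognition function; the advice `r` is successful on input `p` iff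
`F₂⟨p, r⟩` is the zero sequence, the only name of `0` in Sierpiński space. -/
def LasVegasOver {R : Type w} [MeasurableSpace R] (ι : R → Baire) (μ : Measure R) (I : Set ℝ≥0∞)
    {X : Type u} {Y : Type v} [Represented X] [Represented Y] (f : MultiFun X Y) : Prop :=
  ∃ F₁ F₂ : Baire →. Baire, ComputableBaire F₁ ∧ ComputableBaire F₂ ∧
    ∀ p : Baire, ∀ x ∈ Represented.δ (X := X) p, x ∈ f.dom →
      (∀ r : R, (F₂ (pair p (ι r))).Dom) ∧
      {r : R | (fun _ => 0) ∈ F₂ (pair p (ι r))}.Nonempty ∧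
      μ {r : R | (fun _ => 0) ∈ F₂ (pair p (ι r))} ∈ I ∧
      ∀ r : R, (fun _ => 0) ∈ F₂ (pair p (ι r)) →
        ∃ q ∈ F₁ (pair p (ι r)), ∃ y ∈ Represented.δ (X := Y) q, y ∈ f x

/-- Las Vegas computability: over `2^ℕ` with the uniform measure and values in `(0,1]`. -/
def LasVegasComputable {X : Type u} {Y : Type v} [Represented X] [Represented Y]
    (f : MultiFun X Y) : Prop :=
  LasVegasOver cantorToBaire cantorMeasure (Set.Ioc 0 1) f

/-- Las Vegas computability with finitely many mind changes: over `ℕ × 2^ℕ` with the product of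
the counting measure and the uniform measure, and values in `(0,∞]`. -/
def LasVegasFiniteMindChange {X : Type u} {Y : Type v} [Represented X] [Represented Y]
    (f : MultiFun X Y) : Prop :=
  LasVegasOver natCantorToBaire natCantorMeasure (Set.Ioc 0 ⊤) f

end

end Weihrauch

open Weihrauch

/-! ### Closure properties of computable functions -/

attribute [fun_prop] Computable Computable.id Computable.const Computable.comp Computable.pair

namespace ComputableFun

variable {α β γ : Type*} [Primcodable α] [Primcodable β] [Primcodable γ]

@[fun_prop]
theorem fst {f : α → β × γ} (hf : Computable f) : Computable fun a => (f a).1 :=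
  Computable.fst.comp hf

@[fun_prop]
theorem snd {f : α → β × γ} (hf : Computable f) : Computable fun a => (f a).2 :=
  Computable.snd.comp hf

@[fun_prop]
theorem list_take {f : α → ℕ} {g : α → List β} (hf : Computable f) (hg : Computable g) :
    Computable fun a => (g a).take (f a) :=
  Primrec.list_take.to_comp.comp hf hg

@[fun_prop]
theorem list_drop {f : α → ℕ} {g : α → List β} (hf : Computable f) (hg : Computable g) :
    Computable fun a => (g a).drop (f a) :=
  Primrec.list_drop.to_comp.comp hf hg

@[fun_prop]
theorem list_length {g : α → List β} (hg : Computable g) : Computable fun a => (g a).length :=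
  Computable.list_length.comp hg

@[fun_prop]
theorem list_append {f g : α → List β} (hf : Computable f) (hg : Computable g) :
    Computable fun a => f a ++ g a :=
  Computable.list_append.comp hf hg

@[fun_prop]
theorem list_cons {f : α → β} {g : α → List β} (hf : Computable f) (hg : Computable g) :
    Computable fun a => f a :: g a :=
  Computable.list_cons.comp hf hg

@[fun_prop]
theorem list_getD {f : α → List β} {g : α → ℕ} (d : β) (hf : Computable f) (hg : Computable g) :
    Computable fun a => (f a).getD (g a) d :=
  (Primrec.list_getD d).to_comp.comp hf hg

@[fun_prop]
theorem nat_add {f g : α → ℕ} (hf : Computable f) (hg : Computable g) :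
    Computable fun a => f a + g a :=
  Primrec.nat_add.to_comp.comp hf hg

@[fun_prop]
theorem nat_sub {f g : α → ℕ} (hf : Computable f) (hg : Computable g) :
    Computable fun a => f a - g a :=
  Primrec.nat_sub.to_comp.comp hf hg

@[fun_prop]
theorem nat_mul {f g : α → ℕ} (hf : Computable f) (hg : Computable g) :
    Computable fun a => f a * g a :=
  Primrec.nat_mul.to_comp.comp hf hg

@[fun_prop]
theorem nat_div {f g : α → ℕ} (hf : Computable f) (hg : Computable g) :
    Computable fun a => f a / g a :=
  Primrec.nat_div.to_comp.comp hf hg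

@[fun_prop]
theorem nat_mod {f g : α → ℕ} (hf : Computable f) (hg : Computable g) :
    Computable fun a => f a % g a :=
  Primrec.nat_mod.to_comp.comp hf hg

@[fun_prop]
theorem nat_min {f g : α → ℕ} (hf : Computable f) (hg : Computable g) :
    Computable fun a => min (f a) (g a) :=
  Primrec.nat_min.to_comp.comp hf hg

@[fun_prop]
theorem nat_pow {f g : α → ℕ} (hf : Computable f) (hg : Computable g) :
    Computable fun a => f a ^ g a :=
  (Primrec₂.unpaired'.1 Nat.Primrec.pow).to_comp.comp hf hg

@[fun_prop]
theorem nat_unpair {f : α → ℕ} (hf : Computable f) : Computable fun a => (f a).unpair :=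
  Computable.unpair.comp hf

@[fun_prop]
theorem nat_pair {f g : α → ℕ} (hf : Computable f) (hg : Computable g) :
    Computable fun a => Nat.pair (f a) (g a) :=
  Primrec₂.natPair.to_comp.comp hf hg

@[fun_prop]
theorem encode {f : α → β} (hf : Computable f) : Computable fun a => Encodable.encode (f a) :=
  Computable.encode.comp hf

@[fun_prop]
theorem decode {f : α → ℕ} (hf : Computable f) :
    Computable fun a => (Encodable.decode (f a) : Option β) :=
  Computable.decode.comp hf

@[fun_prop]
theorem decide_eq [DecidableEq β] {f g : α → β} (hf : Computable f) (hg : Computable g) :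
    Computable fun a => decide (f a = g a) :=
  Primrec.eq.decide.to_comp.comp hf hg

@[fun_prop]
theorem decide_lt {f g : α → ℕ} (hf : Computable f) (hg : Computable g) :
    Computable fun a => decide (f a < g a) :=
  Primrec.nat_lt.decide.to_comp.comp hf hg

@[fun_prop]
theorem decide_le {f g : α → ℕ} (hf : Computable f) (hg : Computable g) :
    Computable fun a => decide (f a ≤ g a) :=
  Primrec.nat_le.decide.to_comp.comp hf hg

@[fun_prop]
theorem bool_and {f g : α → Bool} (hf : Computable f) (hg : Computable g) :
    Computable fun a => f a && g a :=
  Primrec.and.to_comp.comp hf hg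

@[fun_prop]
theorem bool_or {f g : α → Bool} (hf : Computable f) (hg : Computable g) :
    Computable fun a => f a || g a :=
  Primrec.or.to_comp.comp hf hg

@[fun_prop]
theorem bool_not {f : α → Bool} (hf : Computable f) : Computable fun a => !f a :=
  Primrec.not.to_comp.comp hf

@[fun_prop]
theorem bool_toNat {f : α → Bool} (hf : Computable f) : Computable fun a => (f a).toNat :=
  (Primrec.dom_finite Bool.toNat).to_comp.comp hf

@[fun_prop]
theorem ite {P : α → Prop} [DecidablePred P] {f g : α → β} (hP : Computable fun a => decide (P a))
    (hf : Computable f) (hg : Computable g) : Computable fun a => if P a then f a else g a :=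
  (Computable.cond hP hf hg).of_eq fun a => by by_cases h : P a <;> simp [h]

@[fun_prop]
theorem option_elim {f : α → Option β} {g : α → γ} {h : α → β → γ} (hf : Computable f)
    (hg : Computable g) (hh : Computable fun x : α × β => h x.1 x.2) :
    Computable fun a => (f a).elim (g a) (h a) :=
  (Computable.option_casesOn hf hg hh.to₂).of_eq fun a => by cases f a <;> rfl

theorem nat_rec {f : α → ℕ} {g : α → β} {h : α → ℕ → β → β} (hf : Computable f)
    (hg : Computable g) (hh : Computable fun x : α × ℕ × β => h x.1 x.2.1 x.2.2) :
    Computable fun a => Nat.rec (motive := fun _ => β) (g a) (h a) (f a) :=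
  Computable.nat_rec (h := fun a x => h a x.1 x.2) hf hg hh.to₂

@[fun_prop]
theorem list_range {f : α → ℕ} (hf : Computable f) : Computable fun a => List.range (f a) :=
  Primrec.list_range.to_comp.comp hf

@[fun_prop]
theorem list_map_range {f : α → ℕ} {g : α → ℕ → β} (hf : Computable f)
    (hg : Computable fun x : α × ℕ => g x.1 x.2) :
    Computable fun a => (List.range (f a)).map (g a) := by
  have : Computable fun a => Nat.rec (motive := fun _ => List β) []
      (fun n l => l ++ [g a n]) (f a) :=
    nat_rec hf (by fun_prop) (by
      have : Computable fun x : α × ℕ × List β => g x.1 x.2.1 :=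
        hg.comp (f := fun x : α × ℕ => g x.1 x.2) (g := fun x : α × ℕ × List β => (x.1, x.2.1))
          (by fun_prop)
      fun_prop)
  refine this.of_eq fun a => ?_
  induction f a with
  | zero => rfl
  | succ n ih => simp [ih, List.range_succ]

@[fun_prop]
theorem list_map {f : α → List β} {g : α → β → γ} (hf : Computable f)
    (hg : Computable fun x : α × β => g x.1 x.2) :
    Computable fun a => (f a).map (g a) := by
  have h : Computable fun a => Nat.rec (motive := fun _ => List γ) []
      (fun n l => l ++ (f a)[n]?.elim [] fun b => [g a b]) (f a).length := by
    have h1 : Computable fun x : α × ℕ × List γ => (f x.1)[x.2.1]? :=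
      Computable.list_getElem?.comp (by fun_prop) (by fun_prop)
    have h2 : Computable fun x : (α × ℕ × List γ) × β => g x.1.1 x.2 :=
      hg.comp (f := fun x : α × β => g x.1 x.2)
        (g := fun x : (α × ℕ × List γ) × β => (x.1.1, x.2)) (by fun_prop)
    exact nat_rec (by fun_prop) (by fun_prop) (by fun_prop)
  refine h.of_eq fun a => ?_
  suffices ∀ n, Nat.rec (motive := fun _ => List γ) []
      (fun n l => l ++ (f a)[n]?.elim [] fun b => [g a b]) n = ((f a).take n).map (g a) by
    simpa using this (f a).length
  intro n
  induction n with
  | zero => rfl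
  | succ n ih =>
    rw [List.take_add_one, List.map_append, ← ih]
    change _ ++ (f a)[n]?.elim [] (fun b => [g a b]) = _
    cases (f a)[n]? <;> rfl

@[fun_prop]
theorem list_all {f : α → List β} {g : α → β → Bool} (hf : Computable f)
    (hg : Computable fun x : α × β => g x.1 x.2) :
    Computable fun a => (f a).all (g a) := by
  have h : Computable fun l : List Bool => l.findIdx (fun b => !b) :=
    (Primrec.list_findIdx Primrec.id (Primrec.not.comp Primrec.snd).to₂).to_comp
  have h2 : Computable fun a => decide (((f a).map (g a)).findIdx (fun b => !b) =
    ((f a).map (g a)).length) := by fun_prop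
  refine h2.of_eq fun a => ?_
  induction f a with
  | nil => rfl
  | cons b l ih => 
    cases hb : g a b <;> simp_all [List.findIdx_cons]

end ComputableFun

namespace Weihrauch
open Filter

/-! ### Finite words approximating infinite sequences -/

section Words

variable {α : Type*}

@[simp]
theorem length_initSeg (p : ℕ → α) (k : ℕ) : (initSeg p k).length = k := by simp [initSeg]

@[simp]
theorem take_initSeg (p : ℕ → α) (m k : ℕ) :
    (initSeg p k).take m = initSeg p (min m k) := by
  rw [initSeg, initSeg, ← List.map_take, List.take_range]

theorem getD_initSeg (p : ℕ → α) {i k : ℕ} (h : i < k) (d : α) : (initSeg p k).getD i d = p i := by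
  simp [initSeg, List.getD_eq_getElem?_getD, h]

theorem initSeg_prefix (p : ℕ → α) {m k : ℕ} (h : m ≤ k) : initSeg p m <+: initSeg p k := by
  rw [List.prefix_iff_eq_take, take_initSeg, length_initSeg, min_eq_left h]

theorem drop_initSeg (p : ℕ → α) (m k : ℕ) :
    (initSeg p k).drop m = initSeg (fun i => p (m + i)) (k - m) := by
  refine List.ext_getElem (by simp) fun i h1 h2 => ?_
  simp [initSeg]

theorem map_initSeg {β : Type*} (f : α → β) (p : ℕ → α) (k : ℕ) :
    (initSeg p k).map f = initSeg (fun i => f (p i)) k := by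
  simp [initSeg, Function.comp_def]

theorem eq_initSeg_iff {l : List α} {p : ℕ → α} :
    l = initSeg p l.length ↔ ∀ i (h : i < l.length), l[i] = p i := by
  constructor
  · intro h i hi
    have : l[i]? = (initSeg p l.length)[i]? := by rw [← h]
    simpa [initSeg, hi] using this
  · intro h
    exact List.ext_getElem (by simp) fun i h1 _ => by simp [initSeg, h i h1]

theorem eq_initSeg_of_prefix {l l' : List α} {p : ℕ → α} (h : l <+: l')
    (h' : l' = initSeg p l'.length) : l = initSeg p l.length := by
  obtain ⟨t, rfl⟩ := h
  rw [eq_initSeg_iff] at h' ⊢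
  intro i hi
  rw [← h' i (by simp; omega), List.getElem_append_left hi]

/-- The words `u k` are prefixes of the sequence `q` whose lengths tend to infinity. -/
def Approx (u : ℕ → List ℕ) (q : Baire) : Prop :=
  (∀ k, u k = initSeg q (u k).length) ∧ Tendsto (fun k => (u k).length) atTop atTop

theorem approx_initSeg (p : Baire) : Approx (initSeg p) p :=
  ⟨fun k => by simp, tendsto_id.congr fun k => by simp⟩

theorem Approx.comp_tendsto {u : ℕ → List ℕ} {q : Baire} (h : Approx u q) {m : ℕ → ℕ}
    (hm : Tendsto m atTop atTop) : Approx (fun k => u (m k)) q :=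
  ⟨fun k => h.1 (m k), h.2.comp hm⟩

theorem Approx.prefix_or_prefix {u : ℕ → List ℕ} {q : Baire} (h : Approx u q) (j k : ℕ) :
    u j <+: u k ∨ u k <+: u j := by
  rw [h.1 j, h.1 k]
  rcases le_total (u j).length (u k).length with h | h
  · exact Or.inl (initSeg_prefix q h)
  · exact Or.inr (initSeg_prefix q h)

theorem tendsto_min_atTop {f g : ℕ → ℕ} (hf : Tendsto f atTop atTop) (hg : Tendsto g atTop atTop) :
    Tendsto (fun k => min (f k) (g k)) atTop atTop :=
  tendsto_atTop.2 fun n => by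
    filter_upwards [tendsto_atTop.1 hf n, tendsto_atTop.1 hg n] with k h1 h2 using le_min h1 h2

theorem Approx.take_self {u : ℕ → List ℕ} {q : Baire} (h : Approx u q) :
    Approx (fun k => (u k).take k) q := by
  refine ⟨fun k => ?_, ?_⟩
  · exact eq_initSeg_of_prefix (List.take_prefix _ _) (h.1 k)
  · simp only [List.length_take]
    exact tendsto_min_atTop tendsto_id h.2

/-- The computation of a machine on the word-level approximations of its input. -/
theorem Approx.machine {φ : List ℕ → List ℕ} (hφ : ∀ σ τ, σ <+: τ → φ σ <+: φ τ) {p q : Baire}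
    (h : (∀ k, φ (initSeg p k) = initSeg q (φ (initSeg p k)).length) ∧
      ∀ n, ∃ k, n ≤ (φ (initSeg p k)).length)
    {u : ℕ → List ℕ} (hu : Approx u p) : Approx (fun k => φ (u k)) q := by
  refine ⟨fun k => ?_, tendsto_atTop.2 fun n => ?_⟩
  · have := h.1 (u k).length
    rwa [← hu.1 k] at this
  · obtain ⟨m, hm⟩ := h.2 n
    filter_upwards [tendsto_atTop.1 hu.2 m] with k hk
    refine hm.trans (List.IsPrefix.length_le (hφ _ _ ?_))
    rw [hu.1 k]
    exact initSeg_prefix p hk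

/-- The monotone sequence of words that follows `u` as long as `u` extends what is written. -/
def monotonize (u : ℕ → List ℕ) (n : ℕ) : List ℕ :=
  Nat.rec (u 0) (fun n l => if (u (n + 1)).take l.length = l then u (n + 1) else l) n

theorem monotonize_succ (u : ℕ → List ℕ) (n : ℕ) : monotonize u (n + 1) =
    if (u (n + 1)).take (monotonize u n).length = monotonize u n then u (n + 1)
    else monotonize u n := rfl

theorem monotonize_prefix_succ (u : ℕ → List ℕ) (n : ℕ) :
    monotonize u n <+: monotonize u (n + 1) := by
  rw [monotonize_succ]
  split_ifs with h
  · rw [List.prefix_iff_eq_take, h]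
  · exact List.prefix_rfl

theorem monotonize_prefix (u : ℕ → List ℕ) {m n : ℕ} (h : m ≤ n) :
    monotonize u m <+: monotonize u n := by
  induction n, h using Nat.le_induction with
  | base => exact List.prefix_rfl
  | succ n _ ih => exact ih.trans (monotonize_prefix_succ u n)

theorem monotonize_congr {u v : ℕ → List ℕ} {n : ℕ} (h : ∀ i ≤ n, u i = v i) :
    monotonize u n = monotonize v n := by
  induction n with
  | zero => exact h 0 le_rfl
  | succ n ih => rw [monotonize_succ, monotonize_succ, h _ le_rfl, ih fun i hi => h i (by omega)]

theorem Approx.monotonize {u : ℕ → List ℕ} {q : Baire} (h : Approx u q) :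
    Approx (Weihrauch.monotonize u) q := by
  have key : ∀ n, (∃ m, Weihrauch.monotonize u n = u m) ∧
      (u n).length ≤ (Weihrauch.monotonize u n).length := by
    intro n
    induction n with
    | zero => exact ⟨⟨0, rfl⟩, le_rfl⟩
    | succ n ih =>
      rw [monotonize_succ]
      split_ifs with hn
      · exact ⟨⟨n + 1, rfl⟩, le_rfl⟩
      · refine ⟨ih.1, ?_⟩
        obtain ⟨m, hm⟩ := ih.1
        rw [hm] at hn ⊢
        rcases h.prefix_or_prefix m (n + 1) with h' | h'
        · exact absurd (List.prefix_iff_eq_take.1 h').symm hn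
        · exact h'.length_le
  refine ⟨fun n => ?_, tendsto_atTop_mono (fun n => (key n).2) h.2⟩
  obtain ⟨m, hm⟩ := (key n).1
  rw [hm]
  exact h.1 m

theorem computable_monotonize {β : Type*} [Primcodable β] {f : β → ℕ → List ℕ} {g : β → ℕ}
    (hf : Computable fun x : β × ℕ => f x.1 x.2) (hg : Computable g) :
    Computable fun b => monotonize (f b) (g b) := by
  have h0 : Computable fun b => f b 0 :=
    hf.comp (f := fun x : β × ℕ => f x.1 x.2) (g := fun b => (b, 0)) (by fun_prop)
  have h1 : Computable fun x : β × ℕ × List ℕ => f x.1 (x.2.1 + 1) :=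
    hf.comp (f := fun x : β × ℕ => f x.1 x.2)
      (g := fun x : β × ℕ × List ℕ => (x.1, x.2.1 + 1)) (by fun_prop)
  exact ComputableFun.nat_rec hg h0 (by fun_prop)

/-- A partial function is computable if its values are approximated by a computable function on
words, which need not be monotone. -/
theorem computableBaire_of_approx {F : Baire →. Baire} {θ : List ℕ → List ℕ} (hθ : Computable θ)
    (h : ∀ p, ∀ q ∈ F p, Approx (fun k => θ (initSeg p k)) q) : ComputableBaire F := by
  refine ⟨fun σ => monotonize (fun j => θ (σ.take j)) σ.length,
    computable_monotonize (by fun_prop) (by fun_prop), fun σ τ hστ => ?_, fun p q hq => ?_⟩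
  · have : monotonize (fun j => θ (σ.take j)) σ.length =
        monotonize (fun j => θ (τ.take j)) σ.length := by
      refine monotonize_congr fun i hi => ?_
      obtain ⟨t, rfl⟩ := hστ
      rw [List.take_append_of_le_length hi]
    beta_reduce
    rw [this]
    exact monotonize_prefix _ hστ.length_le
  · have key : ∀ k, monotonize (fun j => θ ((initSeg p k).take j)) (initSeg p k).length =
        monotonize (fun j => θ (initSeg p j)) k := fun k => by
      rw [length_initSeg]
      exact monotonize_congr fun i hi => by rw [take_initSeg, min_eq_left hi]
    have := (h p q hq).monotonize
    refine ⟨fun k => ?_, fun n => ?_⟩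
    · beta_reduce
      rw [key]
      exact this.1 k
    · obtain ⟨k, hk⟩ := (tendsto_atTop.1 this.2 n).exists
      exact ⟨k, by beta_reduce; rwa [key]⟩

/-- The largest partial function computed by `θ`. -/
noncomputable def limitFun (θ : List ℕ → List ℕ) : Baire →. Baire := fun p =>
  ⟨∃ q, Approx (fun k => θ (initSeg p k)) q, fun h => h.choose⟩

theorem computableBaire_limitFun {θ : List ℕ → List ℕ} (hθ : Computable θ) :
    ComputableBaire (limitFun θ) := by
  refine computableBaire_of_approx hθ ?_
  rintro p _ ⟨h, rfl⟩
  exact h.choose_spec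

theorem Approx.unique {u : ℕ → List ℕ} {q q' : Baire} (h : Approx u q) (h' : Approx u q') :
    q = q' := by
  funext n
  obtain ⟨k, hk⟩ := (tendsto_atTop.1 h.2 (n + 1)).exists
  have h1 := eq_initSeg_iff.1 (h.1 k) n (by omega)
  have h2 := eq_initSeg_iff.1 (h'.1 k) n (by omega)
  rw [← h1, h2]

theorem Approx.mem_limitFun {θ : List ℕ → List ℕ} {p q : Baire}
    (h : Approx (fun k => θ (initSeg p k)) q) : q ∈ limitFun θ p :=
  ⟨⟨q, h⟩, (Exists.choose_spec (⟨q, h⟩ : ∃ _, _)).unique h⟩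

/-- The total function whose `n`-th value depends computably on the prefix of length `n`. -/
def prefixFun (g : List ℕ → ℕ) (p : Baire) : Baire := fun n => g (initSeg p n)

theorem computableBaire_prefixFun {g : List ℕ → ℕ} (hg : Computable g) :
    ComputableBaire fun p => Part.some (prefixFun g p) := by
  refine computableBaire_of_approx
    (θ := fun σ => (List.range σ.length).map fun n => g (σ.take n)) (by fun_prop) ?_
  intro p _ hq
  obtain rfl := Part.mem_some_iff.1 hq
  have : ∀ k, (List.range (initSeg p k).length).map (fun n => g ((initSeg p k).take n)) =
      initSeg (prefixFun g p) k := fun k => by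
    rw [length_initSeg]
    refine List.map_congr_left fun n hn => ?_
    rw [take_initSeg, min_eq_left (List.mem_range.1 hn).le, prefixFun]
  simp only [this]
  exact approx_initSeg _

/-! ### Words and pairs of sequences -/

/-- The first component of a word that is a prefix of a pair. -/
def evens (σ : List ℕ) : List ℕ := (List.range (σ.length / 2)).map fun i => σ.getD (2 * i) 0

/-- The second component of a word that is a prefix of a pair. -/
def odds (σ : List ℕ) : List ℕ := (List.range (σ.length / 2)).map fun i => σ.getD (2 * i + 1) 0

/-- The prefix of a pair determined by prefixes of its components. -/
def interleave (σ τ : List ℕ) : List ℕ :=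
  (List.range (2 * min σ.length τ.length)).map fun n =>
    if n % 2 = 0 then σ.getD (n / 2) 0 else τ.getD (n / 2) 0

@[fun_prop]
theorem computable_evens : Computable evens := by unfold evens; fun_prop

@[fun_prop]
theorem computable_odds : Computable odds := by unfold odds; fun_prop

@[fun_prop]
theorem computable_interleave {β : Type*} [Primcodable β] {f g : β → List ℕ} (hf : Computable f)
    (hg : Computable g) : Computable fun b => interleave (f b) (g b) := by
  unfold interleave; fun_prop

theorem evens_initSeg (p : Baire) (k : ℕ) : evens (initSeg p k) = initSeg (unpairFst p) (k / 2) := by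
  rw [evens, length_initSeg]
  refine List.map_congr_left fun i hi => ?_
  rw [List.mem_range] at hi
  rw [getD_initSeg p (by omega), unpairFst]

theorem odds_initSeg (p : Baire) (k : ℕ) : odds (initSeg p k) = initSeg (unpairSnd p) (k / 2) := by
  rw [odds, length_initSeg]
  refine List.map_congr_left fun i hi => ?_
  rw [List.mem_range] at hi
  rw [getD_initSeg p (by omega), unpairSnd]

theorem interleave_initSeg (p q : Baire) (a b : ℕ) :
    interleave (initSeg p a) (initSeg q b) = initSeg (pair p q) (2 * min a b) := by
  rw [interleave, length_initSeg, length_initSeg]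
  refine List.map_congr_left fun i hi => ?_
  rw [List.mem_range] at hi
  rw [pair, getD_initSeg p (by omega), getD_initSeg q (by omega)]

theorem Approx.interleave {u v : ℕ → List ℕ} {p q : Baire} (hu : Approx u p) (hv : Approx v q) :
    Approx (fun k => interleave (u k) (v k)) (pair p q) := by
  have : ∀ k, Weihrauch.interleave (u k) (v k) =
      initSeg (pair p q) (2 * min (u k).length (v k).length) := fun k => by
    conv_lhs => rw [hu.1 k, hv.1 k]
    exact interleave_initSeg p q _ _
  refine ⟨fun k => by beta_reduce; rw [this, length_initSeg], ?_⟩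
  simp only [this, length_initSeg]
  exact (tendsto_min_atTop hu.2 hv.2).const_mul_atTop' two_pos

end Words

/-! ### Problems solvable with advice -/

section Advice

variable {R R₁ R₂ W W₁ W₂ : Type} [Primcodable W] [Primcodable W₁] [Primcodable W₂]
variable {X : Type u} {Y : Type v} [Represented X] [Represented Y]

/-- The advice not refuted on input `p`, where `ρ r s` is the finite information on the advice `r`
that is available at stage `s`. -/
def survivors (ρ : R → ℕ → W) (alive : List ℕ × W → Bool) (p : Baire) : Set R :=
  {r | ∀ s, alive (initSeg p s, ρ r s) = true}

/-- `f` is solvable with advice from `R`: wrong advice is recognized, the set of unrefuted advice is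
large, and a solution is computed from each unrefuted advice. -/
def Solvable (ρ : R → ℕ → W) (large : Set R → Prop) (f : MultiFun X Y) : Prop :=
  ∃ (alive : List ℕ × W → Bool) (out : List ℕ × W → List ℕ), Computable alive ∧ Computable out ∧
    ∀ p : Baire, ∀ x ∈ Represented.δ (X := X) p, x ∈ f.dom →
      large (survivors ρ alive p) ∧ ∀ r ∈ survivors ρ alive p,
        ∃ q, Approx (fun s => out (initSeg p s, ρ r s)) q ∧ ∃ y ∈ Represented.δ (X := Y) q, y ∈ f x

/-- `f` is solvable with two independent pieces of advice, each with its own failure recognition. -/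
def ParallelSolvable (ρ₁ : R₁ → ℕ → W₁) (large₁ : Set R₁ → Prop) (ρ₂ : R₂ → ℕ → W₂)
    (large₂ : Set R₂ → Prop) (f : MultiFun X Y) : Prop :=
  ∃ (alive₁ : List ℕ × W₁ → Bool) (alive₂ : List ℕ × W₂ → Bool)
    (out : List ℕ × W₁ × W₂ → List ℕ), Computable alive₁ ∧ Computable alive₂ ∧ Computable out ∧
    ∀ p : Baire, ∀ x ∈ Represented.δ (X := X) p, x ∈ f.dom →
      large₁ (survivors ρ₁ alive₁ p) ∧ large₂ (survivors ρ₂ alive₂ p) ∧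
      ∀ r₁ ∈ survivors ρ₁ alive₁ p, ∀ r₂ ∈ survivors ρ₂ alive₂ p,
        ∃ q, Approx (fun s => out (initSeg p s, ρ₁ r₁ s, ρ₂ r₂ s)) q ∧
          ∃ y ∈ Represented.δ (X := Y) q, y ∈ f x

/-- Names `t` of advice `r` (in the sense of `N r t`) and the finite information `ρ r s` are
computable from each other. -/
structure NameCoding (ρ : R → ℕ → W) (N : R → Baire → Prop) : Prop where
  exists_enc : ∃ enc : ℕ × W → List ℕ, Computable enc ∧
    ∀ r, ∃ t, N r t ∧ Approx (fun s => enc (s, ρ r s)) t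
  exists_dec : ∃ dec : List ℕ → W, Computable dec ∧
    ∀ r t, N r t → ∀ s, dec (initSeg t (2 * s + 1)) = ρ r s

/-- The sets determined by finite information are numbered balls, uniformly computably, and
membership in balls is recognized from finite information. -/
structure BallCoding [TopologicalSpace R] [NumberedBasis R] (ρ : R → ℕ → W) : Prop where
  exists_cyl : ∃ cyl : ℕ × W → ℕ, Computable cyl ∧
    ∀ s w r, ρ r s = w ↔ ∃ c, cyl (s, w) = c + 1 ∧ r ∈ NumberedBasis.ball c
  exists_hit : ∃ hit : ℕ × W → Bool, Computable hit ∧ (∀ w, hit (0, w) = false) ∧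
    (∀ c r s s', s ≤ s' → hit (c, ρ r s) = true → hit (c, ρ r s') = true) ∧
    ∀ c r, r ∈ NumberedBasis.ball c ↔ ∃ s, hit (c + 1, ρ r s) = true

/-- Earlier finite information is computable from later finite information. -/
def Truncatable (ρ : R → ℕ → W) : Prop :=
  ∃ trunc : ℕ × W → W, Computable trunc ∧ ∀ r m s, m ≤ s → trunc (m, ρ r s) = ρ r m

/-- The product of two kinds of finite information. -/
def prodInfo (ρ₁ : R₁ → ℕ → W₁) (ρ₂ : R₂ → ℕ → W₂) (r : R₁ × R₂) (s : ℕ) : W₁ × W₂ :=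
  (ρ₁ r.1 s, ρ₂ r.2 s)

theorem Solvable.congr_large {ρ : R → ℕ → W} {large large' : Set R → Prop} {f : MultiFun X Y}
    (h : Solvable ρ large f) (hl : ∀ S, large S → large' S) : Solvable ρ large' f := by
  obtain ⟨alive, out, ha, ho, h⟩ := h
  exact ⟨alive, out, ha, ho, fun p x hx hd => ⟨hl _ (h p x hx hd).1, (h p x hx hd).2⟩⟩

theorem Solvable.transport {ρ : R → ℕ → W} {large : Set R → Prop} {f : MultiFun X Y}
    (h : Solvable ρ large f) {ρ' : R₁ → ℕ → W₁} {large' : Set R₁ → Prop} (e : R₁ → R)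
    {c : W₁ → W} (hc : Computable c) (hρ : ∀ r s, ρ (e r) s = c (ρ' r s))
    (hl : ∀ S, large S → large' (e ⁻¹' S)) : Solvable ρ' large' f := by
  obtain ⟨alive, out, ha, ho, h⟩ := h
  refine ⟨fun a => alive (a.1, c a.2), fun a => out (a.1, c a.2), by fun_prop, by fun_prop,
    fun p x hx hd => ?_⟩
  obtain ⟨h1, h2⟩ := h p x hx hd
  have : survivors ρ' (fun a => alive (a.1, c a.2)) p = e ⁻¹' survivors ρ alive p := by
    ext r
    simp [survivors, hρ]
  rw [this]
  refine ⟨hl _ h1, fun r hr => ?_⟩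
  simpa only [hρ] using h2 (e r) hr

theorem ParallelSolvable.symm {ρ₁ : R₁ → ℕ → W₁} {large₁ : Set R₁ → Prop} {ρ₂ : R₂ → ℕ → W₂}
    {large₂ : Set R₂ → Prop} {f : MultiFun X Y} (h : ParallelSolvable ρ₁ large₁ ρ₂ large₂ f) :
    ParallelSolvable ρ₂ large₂ ρ₁ large₁ f := by
  obtain ⟨alive₁, alive₂, out, h1, h2, ho, h⟩ := h
  refine ⟨alive₂, alive₁, fun a => out (a.1, a.2.2, a.2.1), h2, h1, by fun_prop,
    fun p x hx hd => ?_⟩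
  obtain ⟨l1, l2, h⟩ := h p x hx hd
  exact ⟨l2, l1, fun r₂ hr₂ r₁ hr₁ => h r₁ hr₁ r₂ hr₂⟩

theorem ParallelSolvable.solvable_prod {ρ₁ : R₁ → ℕ → W₁} {large₁ : Set R₁ → Prop}
    {ρ₂ : R₂ → ℕ → W₂} {large₂ : Set R₂ → Prop} {f : MultiFun X Y}
    (h : ParallelSolvable ρ₁ large₁ ρ₂ large₂ f) {large : Set (R₁ × R₂) → Prop}
    (hl : ∀ S₁ S₂, large₁ S₁ → large₂ S₂ → large (S₁ ×ˢ S₂)) :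
    Solvable (prodInfo ρ₁ ρ₂) large f := by
  obtain ⟨alive₁, alive₂, out, h1, h2, ho, h⟩ := h
  refine ⟨fun a => alive₁ (a.1, a.2.1) && alive₂ (a.1, a.2.2), out, by fun_prop, ho,
    fun p x hx hd => ?_⟩
  obtain ⟨l1, l2, h⟩ := h p x hx hd
  have : survivors (prodInfo ρ₁ ρ₂) (fun a => alive₁ (a.1, a.2.1) && alive₂ (a.1, a.2.2)) p =
      survivors ρ₁ alive₁ p ×ˢ survivors ρ₂ alive₂ p := by
    ext r
    simp [survivors, prodInfo, forall_and]
  rw [this]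
  exact ⟨hl _ _ l1 l2, fun r hr => h r.1 hr.1 r.2 hr.2⟩

/-- The composition of solvable problems is solvable with advice for both of them. -/
theorem Solvable.comp {Z : Type w} [Represented Z] {ρ₁ : R₁ → ℕ → W₁} {large₁ : Set R₁ → Prop}
    {ρ₂ : R₂ → ℕ → W₂} {large₂ : Set R₂ → Prop} {g : MultiFun Z Y} {h : MultiFun X Z}
    (hg : Solvable ρ₂ large₂ g) (hh : Solvable ρ₁ large₁ h) (ht : Truncatable ρ₂)
    {large : Set (R₁ × R₂) → Prop}
    (hl : ∀ (S₁ : Set R₁) (S₂ : R₁ → Set R₂), large₁ S₁ → (∀ r ∈ S₁, large₂ (S₂ r)) →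
      large {r | r.1 ∈ S₁ ∧ r.2 ∈ S₂ r.1}) :
    Solvable (prodInfo ρ₁ ρ₂) large (g.comp h) := by
  obtain ⟨aliveg, outg, hag, hog, hg⟩ := hg
  obtain ⟨aliveh, outh, hah, hoh, hh⟩ := hh
  obtain ⟨trunc, htc, ht⟩ := ht
  let mid : List ℕ × W₁ × W₂ → List ℕ := fun a => (outh (a.1, a.2.1)).take a.1.length
  have hmid : Computable mid := by fun_prop
  refine ⟨fun a => aliveh (a.1, a.2.1) && (List.range ((mid a).length + 1)).all fun m =>
      aliveg ((mid a).take m, trunc (m, a.2.2)),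
    fun a => outg (mid a, trunc ((mid a).length, a.2.2)), by fun_prop, by fun_prop, ?_⟩
  rintro p x hx ⟨y₀, hsub, z₀, hz₀, hy₀⟩
  obtain ⟨l1, h1⟩ := hh p x hx ⟨z₀, hz₀⟩
  have : Nonempty Z := ⟨z₀⟩
  choose! q hq z hzq hzh using h1
  have key : ∀ r : R₁ × R₂, r.1 ∈ survivors ρ₁ aliveh p →
      ∃ m : ℕ → ℕ, Tendsto m atTop atTop ∧ (∀ s, m s ≤ s) ∧
        ∀ s, mid (initSeg p s, prodInfo ρ₁ ρ₂ r s) = initSeg (q r.1) (m s) := by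
    intro r hr
    have := (hq r.1 hr).take_self
    refine ⟨_, this.2, fun s => by simp, fun s => ?_⟩
    have h2 := this.1 s
    simpa [mid, prodInfo] using h2
  have hsurv : survivors (prodInfo ρ₁ ρ₂) (fun a => aliveh (a.1, a.2.1) &&
      (List.range ((mid a).length + 1)).all fun m =>
        aliveg ((mid a).take m, trunc (m, a.2.2))) p =
      {r | r.1 ∈ survivors ρ₁ aliveh p ∧ r.2 ∈ survivors ρ₂ aliveg (q r.1)} := by
    ext r
    have : r ∈ survivors (prodInfo ρ₁ ρ₂) (fun a => aliveh (a.1, a.2.1) &&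
        (List.range ((mid a).length + 1)).all fun m =>
          aliveg ((mid a).take m, trunc (m, a.2.2))) p ↔ r.1 ∈ survivors ρ₁ aliveh p ∧
        ∀ s, ∀ m ≤ (mid (initSeg p s, prodInfo ρ₁ ρ₂ r s)).length,
          aliveg ((mid (initSeg p s, prodInfo ρ₁ ρ₂ r s)).take m, trunc (m, ρ₂ r.2 s)) = true := by
      simp only [survivors, Set.mem_ofPred_eq, Bool.and_eq_true, forall_and, List.all_eq_true,
        List.mem_range, Nat.lt_succ_iff]
      rfl
    rw [this]
    refine and_congr_right fun hr => ?_
    obtain ⟨m, hm, hms, hmid⟩ := key r hr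
    simp only [hmid, length_initSeg, take_initSeg]
    constructor
    · intro H s
      obtain ⟨k, hk⟩ := (tendsto_atTop.1 hm s).exists
      have := H k s hk
      rwa [min_eq_left hk, ht _ _ _ (hk.trans (hms k))] at this
    · intro H s i hi
      rw [min_eq_left hi, ht _ _ _ (hi.trans (hms s))]
      exact H i
  rw [hsurv]
  refine ⟨hl _ (fun r₁ => survivors ρ₂ aliveg (q r₁)) l1 fun r hr => ?_, fun r hr => ?_⟩
  · exact (hg _ _ (hzq r hr) (hsub (hzh r hr))).1
  · obtain ⟨q', hq', y, hy, hyg⟩ := (hg _ _ (hzq r.1 hr.1) (hsub (hzh r.1 hr.1))).2 r.2 hr.2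
    refine ⟨q', ?_, y, hy, hsub, z r.1, hzh r.1 hr.1, hyg⟩
    obtain ⟨m, hm, hms, hmid⟩ := key r hr.1
    simp only [hmid, length_initSeg]
    have := hq'.comp_tendsto hm
    refine ⟨fun k => ?_, ?_⟩
    · simp only [prodInfo, ht _ _ _ (hms k)]
      exact this.1 k
    · simp only [prodInfo, ht _ _ _ (hms _)]
      exact this.2

/-! ### Reading the advice from a paired input -/

/-- The stage for which the prefix of length `k` of `⟨p, t⟩` provides enough information. -/
def stage (k : ℕ) : ℕ := (k / 2 - 1) / 2

theorem stage_spec (s : ℕ) : stage (4 * s + 2) = s := by unfold stage; omega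

theorem tendsto_stage : Tendsto stage atTop atTop :=
  tendsto_atTop.2 fun n => by
    filter_upwards [eventually_ge_atTop (4 * n + 4)] with k hk
    unfold stage
    omega

/-- The finite information on `p` and `r` contained in a prefix of `⟨p, t⟩`, where `t` is a name
of `r`. -/
def readInput {V : Type} (dec : List ℕ → V) (σ : List ℕ) : List ℕ × V :=
  ((evens σ).take (stage σ.length), dec ((odds σ).take (2 * stage σ.length + 1)))

@[fun_prop]
theorem computable_stage {β : Type*} [Primcodable β] {f : β → ℕ} (hf : Computable f) :
    Computable fun b => stage (f b) := by
  unfold stage; fun_prop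

theorem computable_readInput {dec : List ℕ → W} (hd : Computable dec) :
    Computable (readInput dec) := by
  unfold readInput; fun_prop

theorem readInput_initSeg {V : Type} {ρ : R → ℕ → V} {dec : List ℕ → V} {r : R} {q : Baire}
    (hd : ∀ s, dec (initSeg (unpairSnd q) (2 * s + 1)) = ρ r s) {k : ℕ} (hk : 2 ≤ k) :
    readInput dec (initSeg q k) = (initSeg (unpairFst q) (stage k), ρ r (stage k)) := by
  have h1 : stage k ≤ k / 2 := by unfold stage; omega
  have h2 : 2 * stage k + 1 ≤ k / 2 := by unfold stage; omega
  rw [readInput, length_initSeg, evens_initSeg, odds_initSeg, take_initSeg, take_initSeg,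
    min_eq_left h1, min_eq_left h2, hd]

theorem Approx.ite_nil {u v : ℕ → List ℕ} {q : Baire} (h : Approx u q) {n : ℕ}
    (huv : ∀ k, n ≤ k → v k = u k) : Approx (fun k => if k < n then [] else v k) q := by
  refine ⟨fun k => ?_, (h.2).congr' ?_⟩
  · by_cases hk : k < n
    · simp [hk, initSeg]
    · simpa [hk, huv k (not_lt.1 hk)] using h.1 k
  · filter_upwards [eventually_ge_atTop n] with k hk
    simp [not_lt.2 hk, huv k hk]

theorem approx_readInput {V : Type} {ρ : R → ℕ → V} {dec : List ℕ → V} {r : R} {p t : Baire}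
    (hd : ∀ s, dec (initSeg t (2 * s + 1)) = ρ r s) {out : List ℕ × V → List ℕ} {q : Baire}
    (h : Approx (fun s => out (initSeg p s, ρ r s)) q) :
    Approx (fun k => if (initSeg (pair p t) k).length < 2 then []
      else out (readInput dec (initSeg (pair p t) k))) q := by
  simp only [length_initSeg]
  refine (h.comp_tendsto tendsto_stage).ite_nil fun k hk => ?_
  rw [readInput_initSeg (ρ := ρ) (r := r) (by rwa [unpairSnd_pair]) hk, unpairFst_pair]

/-! ### Las Vegas computability as solvability -/

/-- All entries of a word vanish. -/
def allZero (l : List ℕ) : Bool := l.all fun e => decide (e = 0)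

@[fun_prop]
theorem computable_allZero : Computable allZero := by unfold allZero; fun_prop

theorem forall_allZero_iff {u : ℕ → List ℕ} {q : Baire} (h : Approx u q) :
    (∀ s, allZero (u s) = true) ↔ q = fun _ => 0 := by
  constructor
  · intro H
    funext n
    obtain ⟨k, hk⟩ := (tendsto_atTop.1 h.2 (n + 1)).exists
    have h1 := eq_initSeg_iff.1 (h.1 k) n (by omega)
    rw [← h1]
    simpa using List.all_eq_true.1 (show (u k).all _ = true from H k) _
      (List.getElem_mem (by omega : n < (u k).length))
  · rintro rfl s
    rw [h.1 s]
    simp [allZero, initSeg]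

theorem LasVegasOver.solvable [MeasurableSpace R] {ι : R → Baire} {μ : Measure R} {I : Set ℝ≥0∞}
    {f : MultiFun X Y} {ρ : R → ℕ → W} (hc : NameCoding ρ fun r t => t = ι r)
    (h : LasVegasOver ι μ I f) : Solvable ρ (fun S => μ S ∈ I) f := by
  obtain ⟨F₁, F₂, ⟨φ₁, hφ₁, mono₁, h₁⟩, ⟨φ₂, hφ₂, mono₂, h₂⟩, h⟩ := h
  obtain ⟨enc, henc, he⟩ := hc.exists_enc
  have he : ∀ r, Approx (fun s => enc (s, ρ r s)) (ι r) := fun r => by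
    obtain ⟨t, rfl, ht⟩ := he r
    exact ht
  refine ⟨fun a => allZero (φ₂ (interleave a.1 (enc (a.1.length, a.2)))),
    fun a => φ₁ (interleave a.1 (enc (a.1.length, a.2))), by fun_prop, by fun_prop,
    fun p x hx hd => ?_⟩
  obtain ⟨hdom, -, hI, hsol⟩ := h p x hx hd
  have key : ∀ r, r ∈ survivors ρ (fun a => allZero (φ₂ (interleave a.1 (enc (a.1.length, a.2))))) p ↔
      (fun _ => 0) ∈ F₂ (pair p (ι r)) := by
    intro r
    have hF := Part.get_mem (hdom r)
    have := forall_allZero_iff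
      (((approx_initSeg p).interleave (he r)).machine mono₂ (h₂ _ _ hF))
    simp only [survivors, Set.mem_ofPred_eq, length_initSeg]
    refine Iff.trans this ⟨fun h0 => ?_, fun h0 => Part.mem_unique hF h0⟩
    rwa [h0] at hF
  have hs : survivors ρ (fun a => allZero (φ₂ (interleave a.1 (enc (a.1.length, a.2))))) p =
      {r | (fun _ => 0) ∈ F₂ (pair p (ι r))} := Set.ext key
  refine ⟨by rwa [hs], fun r hr => ?_⟩
  obtain ⟨q, hq, hy⟩ := hsol r ((key r).1 hr)
  simp only [length_initSeg]
  exact ⟨q, ((approx_initSeg p).interleave (he r)).machine mono₁ (h₁ _ _ hq), hy⟩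

theorem Solvable.lasVegasOver [MeasurableSpace R] {ι : R → Baire} {μ : Measure R} {I : Set ℝ≥0∞}
    {f : MultiFun X Y} {ρ : R → ℕ → W} (hc : NameCoding ρ fun r t => t = ι r)
    (hI : ∀ S : Set R, μ S ∈ I → S.Nonempty)
    (h : Solvable ρ (fun S => μ S ∈ I) f) : LasVegasOver ι μ I f := by
  obtain ⟨alive, out, ha, ho, h⟩ := h
  obtain ⟨dec, hdec, hd⟩ := hc.exists_dec
  have hr := computable_readInput hdec
  let g : List ℕ → ℕ := fun σ =>
    if σ.length < 2 then 0 else if alive (readInput dec σ) = true then 0 else 1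
  have hg : Computable g := by
    have : Computable fun σ => decide (alive (readInput dec σ) = true) :=
      (ha.comp hr).of_eq fun σ => by simp
    fun_prop
  refine ⟨limitFun fun σ => if σ.length < 2 then [] else out (readInput dec σ),
    fun p => Part.some (prefixFun g p), computableBaire_limitFun (by fun_prop),
    computableBaire_prefixFun hg, fun p x hx hdom => ?_⟩
  obtain ⟨hl, hsol⟩ := h p x hx hdom
  have key : ∀ r, (fun _ => 0) ∈ (Part.some (prefixFun g (pair p (ι r))) : Part Baire) ↔
      r ∈ survivors ρ alive p := by
    intro r
    have hread : ∀ k, 2 ≤ k → readInput dec (initSeg (pair p (ι r)) k) =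
        (initSeg p (stage k), ρ r (stage k)) := fun k hk => by
      rw [readInput_initSeg (ρ := ρ) (r := r) (by rw [unpairSnd_pair]; exact hd r _ rfl) hk,
        unpairFst_pair]
    rw [Part.mem_some_iff, eq_comm, funext_iff]
    constructor
    · intro H s
      have := H (4 * s + 2)
      rw [prefixFun] at this
      simp only [g, length_initSeg, hread _ (show 2 ≤ 4 * s + 2 by omega), stage_spec] at this
      by_contra hne
      simp [hne] at this
    · intro H k
      rw [prefixFun]
      by_cases hk : k < 2
      · simp only [g, length_initSeg, hk, if_true]
      · simp [g, hread k (not_lt.1 hk), H (stage k)]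
  have hs : {r | (fun _ => 0) ∈ (Part.some (prefixFun g (pair p (ι r))) : Part Baire)} =
      survivors ρ alive p := Set.ext key
  refine ⟨fun r => trivial, ?_, ?_, fun r hr => ?_⟩
  · rw [hs]; exact hI _ hl
  · rw [hs]; exact hl
  · obtain ⟨q, hq, hy⟩ := hsol r ((key r).1 hr)
    exact ⟨q, (approx_readInput (hd r _ rfl) hq).mem_limitFun, hy⟩

end Advice

/-! ### Weihrauch reducibility to choice as solvability -/

section Reducibility

/-- Weihrauch reducibility in terms of instances and solutions instead of realizers. -/
theorem wReducible_iff {X Y Z W : Type*} [Represented X] [Represented Y] [Represented Z]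
    [Represented W] {f : MultiFun X Y} {g : MultiFun Z W} :
    WReducible f g ↔ ∃ K H : Baire →. Baire, ComputableBaire K ∧ ComputableBaire H ∧
      ∀ p : Baire, ∀ x ∈ Represented.δ (X := X) p, x ∈ f.dom →
        ∃ s ∈ K p, ∃ z ∈ Represented.δ (X := Z) s, z ∈ g.dom ∧
          ∀ t, ∀ w ∈ Represented.δ (X := W) t, w ∈ g z →
            ∃ q ∈ H (pair p t), ∃ y ∈ Represented.δ (X := Y) q, y ∈ f x := by
  classical
  refine exists_congr fun K => exists_congr fun H => and_congr_right fun _ =>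
    and_congr_right fun _ => ⟨fun h p x hx hd => ?_, fun h G hG p x hx hd => ?_⟩
  · let G₀ : Baire →. Baire := fun s =>
      ⟨∃ t, ∃ z ∈ Represented.δ (X := Z) s, ∃ w ∈ Represented.δ (X := W) t, w ∈ g z,
        fun h => h.choose⟩
    have hG₀ : Realizes G₀ g := by
      rintro s z hz ⟨w, hw⟩
      obtain ⟨t, ht⟩ := Represented.surj w
      have hex : ∃ t, ∃ z ∈ Represented.δ (X := Z) s, ∃ w ∈ Represented.δ (X := W) t, w ∈ g z :=
        ⟨t, z, hz, w, ht, hw⟩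
      obtain ⟨z', hz', w', hw', hg⟩ := hex.choose_spec
      obtain rfl := Part.mem_unique hz hz'
      exact ⟨hex.choose, ⟨hex, rfl⟩, w', hw', hg⟩
    obtain ⟨q, hq, -⟩ := h G₀ hG₀ p x hx hd
    simp only [Part.mem_bind_iff] at hq
    obtain ⟨s, hs, t₀, ⟨⟨_, z, hz, w₀, _, hw₀⟩, _⟩, -⟩ := hq
    refine ⟨s, hs, z, hz, ⟨w₀, hw₀⟩, fun t w hw hwz => ?_⟩
    have hG₁ : Realizes (fun s' => if s' = s then Part.some t else G₀ s') g := by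
      intro s' z' hz' hd'
      by_cases hss : s' = s
      · subst hss
        obtain rfl := Part.mem_unique hz hz'
        exact ⟨t, by simp, w, hw, hwz⟩
      · simpa only [if_neg hss] using hG₀ s' z' hz' hd'
    obtain ⟨q, hq, hy⟩ := h _ hG₁ p x hx hd
    simp only [Part.mem_bind_iff] at hq
    obtain ⟨s', hs', t', ht', hq⟩ := hq
    obtain rfl := Part.mem_unique hs hs'
    rw [if_pos rfl, Part.mem_some_iff] at ht'
    subst ht'
    exact ⟨q, hq, hy⟩
  · obtain ⟨s, hs, z, hz, hzd, h⟩ := h p x hx hd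
    obtain ⟨t, ht, w, hw, hwz⟩ := hG s z hz hzd
    obtain ⟨q, hq, hy⟩ := h t w hw hwz
    exact ⟨q, Part.mem_bind_iff.2 ⟨s, hs, Part.mem_bind_iff.2 ⟨t, ht, hq⟩⟩, hy⟩

variable {R R₁ R₂ W W₁ W₂ : Type} [Primcodable W] [Primcodable W₁] [Primcodable W₂]
variable {X : Type u} {Y : Type v} [Represented X] [Represented Y]

/-- Choice for the closed sets that are large. -/
def largeChoice [TopologicalSpace R] (large : Set R → Prop) : MultiFun (Closeds R) R :=
  fun A => {r | large A ∧ r ∈ A}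

/-- No ball enumerated by the word contains the advice. -/
def avoids (hit : ℕ × W → Bool) (a : List ℕ × W) : Bool := a.1.all fun e => !hit (e, a.2)

theorem computable_avoids {hit : ℕ × W → Bool} (h : Computable hit) : Computable (avoids hit) := by
  unfold avoids; fun_prop

theorem mem_closedOfName [TopologicalSpace R] [NumberedBasis R] {p : Baire} {r : R} :
    r ∈ (closedOfName p : Closeds R) ↔ ∀ i c, p i = c + 1 → r ∉ NumberedBasis.ball c := by
  change r ∈ (⋃ (i : ℕ) (c : ℕ) (_ : p i = c + 1), NumberedBasis.ball c)ᶜ ↔ _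
  simp

theorem mem_closedOfName_iff_avoids [TopologicalSpace R] [NumberedBasis R] {V : Type}
    {ρ : R → ℕ → V}
    {hit : ℕ × V → Bool} (h0 : ∀ w, hit (0, w) = false)
    (hmono : ∀ c r s s', s ≤ s' → hit (c, ρ r s) = true → hit (c, ρ r s') = true)
    (hball : ∀ c r, r ∈ NumberedBasis.ball c ↔ ∃ s, hit (c + 1, ρ r s) = true)
    {u : ℕ → List ℕ} {q : Baire} (hu : Approx u q) (r : R) :
    r ∈ (closedOfName q : Closeds R) ↔ ∀ s, avoids hit (u s, ρ r s) = true := by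
  rw [mem_closedOfName]
  constructor
  · intro h s
    rw [avoids, List.all_eq_true]
    intro e he
    by_contra hne
    obtain ⟨i, hi, rfl⟩ := List.getElem_of_mem he
    have hq := eq_initSeg_iff.1 (hu.1 s) i hi
    cases hc : (u s)[i] with
    | zero => simp [hc, h0] at hne
    | succ c => exact h i c (by rw [← hq, hc]) ((hball c r).2 ⟨s, by simpa [hc] using hne⟩)
  · intro h i c hc hr
    obtain ⟨s₀, hs₀⟩ := (hball c r).1 hr
    obtain ⟨s, hs, hs'⟩ := ((tendsto_atTop.1 hu.2 (i + 1)).and (eventually_ge_atTop s₀)).exists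
    have hq := eq_initSeg_iff.1 (hu.1 s) i (by omega)
    have := h s
    rw [avoids, List.all_eq_true] at this
    have := this _ (List.getElem_mem (by omega : i < (u s).length))
    rw [hq, hc, hmono _ _ _ _ hs' hs₀] at this
    simp at this

/-- The set of survivors has a negative name computable from the input. -/
theorem BallCoding.exists_name [TopologicalSpace R] [NumberedBasis R] {ρ : R → ℕ → W}
    (hb : BallCoding ρ) {alive : List ℕ × W → Bool} (ha : Computable alive) :
    ∃ g : List ℕ → ℕ, Computable g ∧
      ∀ p, ((closedOfName (prefixFun g p) : Closeds R) : Set R) = survivors ρ alive p := by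
  obtain ⟨cyl, hcyl, hc⟩ := hb.exists_cyl
  have hdec : Computable fun x : List ℕ × W =>
      decide (alive (x.1.take x.1.length.unpair.1, x.2) = true) :=
    Computable.of_eq (f := fun x : List ℕ × W => alive (x.1.take x.1.length.unpair.1, x.2))
      (by fun_prop) fun σ => by simp
  refine ⟨fun σ => (Encodable.decode σ.length.unpair.2 : Option W).elim 0 fun w =>
    if alive (σ.take σ.length.unpair.1, w) = true then 0 else cyl (σ.length.unpair.1, w),
    by fun_prop, fun p => ?_⟩
  ext r
  rw [SetLike.mem_coe, mem_closedOfName]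
  constructor
  · intro h s
    by_contra hne
    obtain ⟨c, hc1, hc2⟩ := (hc s _ r).1 rfl
    refine h (Nat.pair s (Encodable.encode (ρ r s))) c ?_ hc2
    have hle : s ≤ Nat.pair s (Encodable.encode (ρ r s)) := Nat.left_le_pair _ _
    simp [prefixFun, hle, hne, hc1]
  · intro h i c hic hr
    simp only [prefixFun, length_initSeg, take_initSeg] at hic
    cases hw : (Encodable.decode i.unpair.2 : Option W) with
    | none => simp [hw] at hic
    | some w =>
      rw [hw, Option.elim_some, min_eq_left (Nat.unpair_left_le i)] at hic
      split_ifs at hic with hal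
      exact hal ((hc _ _ r).2 ⟨c, hic, hr⟩ ▸ h _)

theorem Solvable.wReducible [TopologicalSpace R] [NumberedBasis R] [Represented R]
    {ρ : R → ℕ → W} (hb : BallCoding ρ) (hn : NameCoding ρ fun r t => r ∈ Represented.δ t)
    {large : Set R → Prop} (hl : ∀ S, large S → S.Nonempty) {f : MultiFun X Y}
    (h : Solvable ρ large f) : WReducible f (largeChoice large) := by
  obtain ⟨alive, out, ha, ho, h⟩ := h
  obtain ⟨g, hg, hname⟩ := hb.exists_name ha
  obtain ⟨dec, hdec, hd⟩ := hn.exists_dec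
  have hr := computable_readInput hdec
  refine wReducible_iff.2 ⟨_, _, computableBaire_prefixFun hg,
    computableBaire_limitFun (θ := fun σ => if σ.length < 2 then [] else out (readInput dec σ))
      (by fun_prop), fun p x hx hdom => ?_⟩
  obtain ⟨hlarge, h⟩ := h p x hx hdom
  refine ⟨_, Part.mem_some _, _, Part.mem_some _, ?_, ?_⟩
  · obtain ⟨r, hr⟩ := hl _ hlarge
    rw [← hname] at hlarge hr
    exact ⟨r, hlarge, hr⟩
  · rintro t r ht ⟨-, hrA⟩
    have hrs : r ∈ survivors ρ alive p := by rwa [← hname]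
    obtain ⟨q, hq, hy⟩ := h r hrs
    exact ⟨q, (approx_readInput (hd r t ht) hq).mem_limitFun, hy⟩

theorem WReducible.solvable [TopologicalSpace R] [NumberedBasis R] [Represented R]
    {ρ : R → ℕ → W} (hb : BallCoding ρ) (hn : NameCoding ρ fun r t => r ∈ Represented.δ t)
    {large : Set R → Prop} {f : MultiFun X Y}
    (h : WReducible f (largeChoice large)) : Solvable ρ large f := by
  obtain ⟨K, H, ⟨φ, hφ, φmono, hK⟩, ⟨ψ, hψ, ψmono, hH⟩, h⟩ := wReducible_iff.1 h
  obtain ⟨hit, hhit, h0, hmono, hball⟩ := hb.exists_hit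
  obtain ⟨enc, henc, he⟩ := hn.exists_enc
  have hav := computable_avoids hhit
  refine ⟨fun a => avoids hit (φ a.1, a.2), fun a => ψ (interleave a.1 (enc (a.1.length, a.2))),
    by fun_prop, by fun_prop, fun p x hx hd => ?_⟩
  obtain ⟨s, hs, A, hA, ⟨_, hlarge, -⟩, h⟩ := h p x hx hd
  obtain rfl : A = closedOfName s := Part.mem_some_iff.1 hA
  have key : ∀ r, r ∈ (closedOfName s : Closeds R) ↔
      r ∈ survivors ρ (fun a => avoids hit (φ a.1, a.2)) p :=
    mem_closedOfName_iff_avoids h0 hmono hball ((approx_initSeg p).machine φmono (hK _ _ hs))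
  have hS : ((closedOfName s : Closeds R) : Set R) =
      survivors ρ (fun a => avoids hit (φ a.1, a.2)) p := Set.ext key
  refine ⟨hS ▸ hlarge, fun r hr => ?_⟩
  obtain ⟨t, ht, hte⟩ := he r
  obtain ⟨q, hq, hy⟩ := h t r ht ⟨hlarge, (key r).2 hr⟩
  simp only [length_initSeg]
  exact ⟨q, ((approx_initSeg p).interleave hte).machine ψmono (hH _ _ hq), hy⟩

/-! ### Decomposition of problems solvable with two independent pieces of advice -/

/-- Baire space represented by the identity. -/
@[reducible]
def representedBaire : Represented (ULift.{w} Baire) where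
  δ := fun p => Part.some ⟨p⟩
  surj := fun x => ⟨x.down, Part.mem_some _⟩

theorem ParallelSolvable.exists_comp {ρ₁ : R₁ → ℕ → W₁} {large₁ : Set R₁ → Prop}
    {ρ₂ : R₂ → ℕ → W₂} {large₂ : Set R₂ → Prop} {f : MultiFun X Y}
    {N : R₁ → Baire → Prop} (hN : NameCoding ρ₁ N) (ht : Truncatable ρ₂)
    (hl : ∀ S, large₁ S → S.Nonempty) (h : ParallelSolvable ρ₁ large₁ ρ₂ large₂ f) :
    ∃ (Z : Type w) (_ : Represented Z) (g : MultiFun Z Y) (h : MultiFun X Z),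
      Solvable ρ₂ large₂ g ∧ Solvable ρ₁ large₁ h ∧ f = g.comp h := by
  obtain ⟨alive₁, alive₂, out, h1, h2, ho, h⟩ := h
  obtain ⟨enc, henc, he⟩ := hN.exists_enc
  obtain ⟨dec, hdec, hd⟩ := hN.exists_dec
  obtain ⟨trunc, htc, ht⟩ := ht
  have hr := computable_readInput hdec
  let good : Baire → Prop := fun q =>
    ∃ r₁ ∈ survivors ρ₁ alive₁ (unpairFst q), N r₁ (unpairSnd q)
  refine ⟨ULift.{w} Baire, representedBaire,
    fun q => {y | good q.down ∧ ∃ x ∈ Represented.δ (unpairFst q.down), y ∈ f x},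
    fun x => {q | x ∈ f.dom ∧ x ∈ Represented.δ (unpairFst q.down) ∧ good q.down}, ?_, ?_, ?_⟩
  · refine ⟨fun a => decide (a.1.length < 2) ||
        alive₂ ((readInput dec a.1).1, trunc (stage a.1.length, a.2)),
      fun a => if a.1.length < 2 then [] else
        out ((readInput dec a.1).1, (readInput dec a.1).2, trunc (stage a.1.length, a.2)),
      by fun_prop, by fun_prop, ?_⟩
    rintro q z hz ⟨y₀, ⟨r₁, hr₁, hN₁⟩, x, hx, hy₀⟩
    obtain rfl : z = ⟨q⟩ := Part.mem_some_iff.1 hz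
    obtain ⟨-, l2, h⟩ := h _ x hx ⟨y₀, hy₀⟩
    have hread : ∀ k, 2 ≤ k → readInput dec (initSeg q k) =
        (initSeg (unpairFst q) (stage k), ρ₁ r₁ (stage k)) := fun k hk =>
      readInput_initSeg (hd r₁ _ hN₁) hk
    have hst : ∀ k, stage k ≤ k := fun k => by unfold stage; omega
    have hS : survivors ρ₂ (fun a => decide (a.1.length < 2) ||
        alive₂ ((readInput dec a.1).1, trunc (stage a.1.length, a.2))) q =
        survivors ρ₂ alive₂ (unpairFst q) := by
      ext r
      constructor
      · intro H s
        have := H (4 * s + 2)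
        beta_reduce at this
        rw [hread _ (by omega), length_initSeg, ht _ _ _ (hst _), stage_spec] at this
        simpa using this
      · intro H k
        by_cases hk : k < 2
        · simp [hk]
        · beta_reduce
          rw [hread _ (not_lt.1 hk), length_initSeg, ht _ _ _ (hst _), H (stage k), Bool.or_true]
    rw [hS]
    refine ⟨l2, fun r₂ hr₂ => ?_⟩
    obtain ⟨q', hq', y, hy, hyx⟩ := h r₁ hr₁ r₂ hr₂
    refine ⟨q', ?_, y, hy, ⟨r₁, hr₁, hN₁⟩, x, hx, hyx⟩
    simp only [length_initSeg]
    refine (hq'.comp_tendsto tendsto_stage).ite_nil fun k hk => ?_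
    rw [hread k hk, ht _ _ _ (hst _)]
  · refine ⟨alive₁, fun a => interleave a.1 (enc (a.1.length, a.2)), h1, by fun_prop, ?_⟩
    rintro p x hx ⟨-, hxd, -⟩
    refine ⟨(h p x hx hxd).1, fun r hr => ?_⟩
    obtain ⟨t, hNt, hte⟩ := he r
    simp only [length_initSeg]
    refine ⟨pair p t, (approx_initSeg p).interleave hte, ⟨pair p t⟩, Part.mem_some _, hxd, ?_, r, ?_⟩
    · rwa [unpairFst_pair]
    · rw [unpairFst_pair, unpairSnd_pair]
      exact ⟨hr, hNt⟩
  · funext x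
    ext y
    constructor
    · intro hy
      have hxd : x ∈ f.dom := ⟨y, hy⟩
      obtain ⟨p, hp⟩ := Represented.surj x
      obtain ⟨r, hr⟩ := hl _ (h p x hp hxd).1
      obtain ⟨t, hNt, -⟩ := he r
      refine ⟨?_, ⟨pair p t⟩, ⟨hxd, ?_, r, ?_, ?_⟩, ⟨r, ?_, ?_⟩, x, ?_, hy⟩
      · rintro q ⟨-, hq, hgood⟩
        exact ⟨y, hgood, x, hq, hy⟩
      all_goals simpa only [unpairFst_pair, unpairSnd_pair]
    · rintro ⟨-, q, ⟨-, hq, -⟩, -, x', hx', hy⟩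
      rwa [Part.mem_unique hq hx']

end Reducibility

/-! ### Finitely many mind changes as solvability with discrete advice -/

section MindChanges

variable {X : Type u} {Y : Type v} [Represented X] [Represented Y]

/-- The information on a natural number: the number itself. -/
def natInfo (n : ℕ) (_ : ℕ) : ℕ := n

theorem getElem?_eventually {u : ℕ → List ℕ} {q : Baire} (h : Approx u q) (n : ℕ) :
    ∃ k₀, ∀ k ≥ k₀, (u k)[n]? = some (q n) := by
  obtain ⟨k₀, hk₀⟩ := eventually_atTop.1 (tendsto_atTop.1 h.2 (n + 1))
  refine ⟨k₀, fun k hk => ?_⟩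
  have hlt : n < (u k).length := hk₀ k hk
  rw [List.getElem?_eq_getElem hlt, eq_initSeg_iff.1 (h.1 k) n hlt]

theorem approx_of_eventually_prefix {u : ℕ → List ℕ} {q : Baire} {n₀ : ℕ}
    (hu : ∀ k ≥ n₀, u k <+: u (k + 1)) (hq : ∀ n, ∃ k₀, ∀ k ≥ k₀, (u k)[n]? = some (q n)) :
    Approx (fun k => if k < n₀ then [] else u k) q := by
  have hpre : ∀ j k, n₀ ≤ j → j ≤ k → u j <+: u k := by
    intro j k hj hk
    induction k, hk using Nat.le_induction with
    | base => exact List.prefix_rfl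
    | succ k hk ih => exact ih.trans (hu k (hj.trans hk))
  refine ⟨fun k => ?_, tendsto_atTop.2 fun n => ?_⟩
  · by_cases hk : k < n₀
    · simp [hk, initSeg]
    · simp only [hk, if_false]
      refine eq_initSeg_iff.2 fun i hi => ?_
      obtain ⟨k₀, hk₀⟩ := hq i
      obtain ⟨t, ht⟩ := hpre k (max k k₀) (not_lt.1 hk) (le_max_left _ _)
      have := hk₀ _ (le_max_right k k₀)
      rw [← ht, List.getElem?_append_left hi, List.getElem?_eq_getElem hi] at this
      exact Option.some.inj this
  · obtain ⟨k₀, hk₀⟩ := hq n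
    filter_upwards [eventually_ge_atTop (max n₀ k₀)] with k hk
    have h1 : ¬ k < n₀ := by have := le_max_left n₀ k₀; omega
    simp only [h1, if_false]
    obtain ⟨hlt, -⟩ := List.getElem?_eq_some_iff.1 (hk₀ k ((le_max_right _ _).trans hk))
    exact hlt.le

theorem FiniteMindChangeComputable.solvable {f : MultiFun X Y}
    (h : FiniteMindChangeComputable f) : Solvable natInfo Set.Nonempty f := by
  obtain ⟨F, ⟨φ, hφ, hF⟩, h⟩ := h
  refine ⟨fun a => decide (a.1.length ≤ a.2) ||
      decide ((φ a.1).take (φ (a.1.take (a.1.length - 1))).length =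
        φ (a.1.take (a.1.length - 1))),
    fun a => if a.1.length < a.2 then [] else φ a.1, by fun_prop, by fun_prop,
    fun p x hx hd => ?_⟩
  obtain ⟨q, hq, hy⟩ := h p x hx hd
  obtain ⟨hfin, hlim⟩ := hF p q hq
  have key : ∀ n, n ∈ survivors natInfo (fun a : List ℕ × ℕ => decide (a.1.length ≤ a.2) ||
      decide ((φ a.1).take (φ (a.1.take (a.1.length - 1))).length =
        φ (a.1.take (a.1.length - 1)))) p ↔
      ∀ k ≥ n, φ (initSeg p k) <+: φ (initSeg p (k + 1)) := by
    intro n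
    simp only [survivors, natInfo, Set.mem_ofPred_eq, length_initSeg, take_initSeg,
      Bool.or_eq_true, decide_eq_true_eq]
    constructor
    · intro H k hk
      have := (H (k + 1)).resolve_left (by omega)
      rw [show min (k + 1 - 1) (k + 1) = k by omega] at this
      rw [List.prefix_iff_eq_take, this]
    · intro H k
      by_cases hk : k ≤ n
      · exact Or.inl hk
      · right
        have := H (k - 1) (by omega)
        rw [show k - 1 + 1 = k by omega] at this
        rw [show min (k - 1) k = k - 1 by omega]
        exact (List.prefix_iff_eq_take.1 this).symm
  refine ⟨?_, fun n hn => ?_⟩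
  · obtain ⟨b, hb⟩ := hfin.bddAbove
    refine ⟨b + 1, (key _).2 fun k hk => ?_⟩
    by_contra hne
    exact absurd (hb hne) (by omega)
  · refine ⟨q, ?_, hy⟩
    simpa only [natInfo, length_initSeg] using approx_of_eventually_prefix ((key n).1 hn) hlim

/-- The least advice not refuted by the prefixes of a word, as a function of the word. -/
def leastAlive (alive : List ℕ × ℕ → Bool) (σ : List ℕ) : ℕ :=
  ((List.range (σ.length + 1)).map fun n =>
    (List.range (σ.length + 1)).all fun s => alive (σ.take s, n)).findIdx fun b => b

theorem computable_leastAlive {alive : List ℕ × ℕ → Bool} (h : Computable alive) :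
    Computable (leastAlive alive) := by
  have h1 : Computable fun l : List Bool => l.findIdx fun b => b :=
    (Primrec.list_findIdx Primrec.id Primrec₂.right).to_comp
  unfold leastAlive
  fun_prop

theorem leastAlive_eventually {alive : List ℕ × ℕ → Bool} {p : Baire}
    (h : (survivors natInfo alive p).Nonempty) :
    ∃ n ∈ survivors natInfo alive p, ∃ k₀, ∀ k ≥ k₀, leastAlive alive (initSeg p k) = n := by
  classical
  have hex : ∃ n, n ∈ survivors natInfo alive p := h
  refine ⟨Nat.find hex, Nat.find_spec hex, ?_⟩
  have href : ∀ m, ∃ s, m < Nat.find hex → alive (initSeg p s, m) = false := by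
    intro m
    by_cases hm : m < Nat.find hex
    · have := Nat.find_min hex hm
      simp only [survivors, natInfo, Set.mem_ofPred_eq, not_forall, Bool.not_eq_true] at this
      obtain ⟨s, hs⟩ := this
      exact ⟨s, fun _ => hs⟩
    · exact ⟨0, fun h => absurd h hm⟩
  choose s hs using href
  refine ⟨Nat.find hex + ∑ m ∈ Finset.range (Nat.find hex), s m, fun k hk => ?_⟩
  rw [leastAlive, length_initSeg, List.findIdx_eq (by rw [List.length_map, List.length_range]; omega)]
  refine ⟨?_, fun j hj => ?_⟩
  · simp only [List.getElem_map, List.getElem_range, List.all_eq_true, List.mem_range,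
      take_initSeg]
    intro i _
    exact Nat.find_spec hex _
  · have hsk : s j ≤ k := (Finset.single_le_sum (f := s) (fun _ _ => Nat.zero_le _)
      (Finset.mem_range.2 hj)).trans (by omega)
    simp only [List.getElem_map, List.getElem_range, List.all_eq_false, List.mem_range,
      take_initSeg]
    exact ⟨s j, by omega, by rw [min_eq_left hsk, hs j hj]; simp⟩

theorem Solvable.finiteMindChangeComputable {f : MultiFun X Y}
    (h : Solvable natInfo Set.Nonempty f) : FiniteMindChangeComputable f := by
  obtain ⟨alive, out, ha, ho, h⟩ := h
  let θ : List ℕ → List ℕ := fun σ =>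
    monotonize (fun j => out (σ.take j, leastAlive alive σ)) σ.length
  have hl := computable_leastAlive ha
  have hθ : Computable θ := computable_monotonize (by fun_prop) (by fun_prop)
  let good : Baire → Baire → Prop := fun p q =>
    {k | ¬ θ (initSeg p k) <+: θ (initSeg p (k + 1))}.Finite ∧
      ∀ n, ∃ k₀, ∀ k ≥ k₀, (θ (initSeg p k))[n]? = some (q n)
  refine ⟨fun p => ⟨∃ q, good p q, fun h => h.choose⟩, ⟨θ, hθ, ?_⟩, fun p x hx hd => ?_⟩
  · rintro p _ ⟨hex, rfl⟩
    exact hex.choose_spec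
  · obtain ⟨hne, h⟩ := h p x hx hd
    obtain ⟨n, hn, k₀, hk₀⟩ := leastAlive_eventually hne
    obtain ⟨q, hq, hy⟩ := h n hn
    have hmono := hq.monotonize
    have hθ : ∀ k ≥ k₀, θ (initSeg p k) =
        monotonize (fun s => out (initSeg p s, natInfo n s)) k := fun k hk => by
      simp only [θ, hk₀ k hk, length_initSeg]
      exact monotonize_congr fun i hi => by rw [take_initSeg, min_eq_left hi, natInfo]
    have hgood : good p q := by
      refine ⟨(Set.finite_lt_nat k₀).subset fun k hk => ?_, fun m => ?_⟩
      · by_contra hlt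
        have hlt : k₀ ≤ k := not_lt.1 hlt
        refine hk ?_
        rw [hθ k hlt, hθ (k + 1) (by omega)]
        exact monotonize_prefix_succ _ k
      · obtain ⟨k₁, hk₁⟩ := getElem?_eventually hmono m
        refine ⟨max k₀ k₁, fun k hk => ?_⟩
        rw [hθ k ((le_max_left _ _).trans hk)]
        exact hk₁ k ((le_max_right _ _).trans hk)
    have hex : ∃ q, good p q := ⟨q, hgood⟩
    refine ⟨hex.choose, ⟨hex, rfl⟩, ?_⟩
    have : hex.choose = q := by
      funext m
      obtain ⟨k₁, h1⟩ := hex.choose_spec.2 m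
      obtain ⟨k₂, h2⟩ := hgood.2 m
      have := h1 (max k₁ k₂) (le_max_left _ _)
      rw [h2 _ (le_max_right _ _)] at this
      exact (Option.some.inj this).symm
    rwa [this]

end MindChanges

/-! ### Counting words and the uniform measure -/

section CantorMeasure

/-- The binary words of length `n`. -/
def words (n : ℕ) : List (List Bool) :=
  Nat.rec [[]] (fun _ l => l.flatMap fun w => [false :: w, true :: w]) n

theorem words_succ (n : ℕ) :
    words (n + 1) = (words n).flatMap fun w => [false :: w, true :: w] := rfl

theorem mem_words {n : ℕ} {w : List Bool} : w ∈ words n ↔ w.length = n := by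
  induction n generalizing w with
  | zero => simp [words]
  | succ n ih =>
    rw [words_succ]
    cases w with
    | nil => simp
    | cons b w => cases b <;> simp [ih]

theorem nodup_words (n : ℕ) : (words n).Nodup := by
  induction n with
  | zero => simp [words]
  | succ n ih =>
    rw [words_succ, List.nodup_flatMap]
    refine ⟨fun w _ => by simp, ih.imp fun {a b} hab => ?_⟩
    simp [Function.onFun, List.disjoint_left, hab]

@[fun_prop]
theorem computable_words {β : Type*} [Primcodable β] {f : β → ℕ} (hf : Computable f) :
    Computable fun b => words (f b) := by
  refine Computable.comp (f := words) ?_ hf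
  refine (Primrec.nat_rec₁ _ ?_).to_comp
  refine Primrec.list_flatMap Primrec.snd ?_
  exact (Primrec.list_cons.comp (Primrec.list_cons.comp (Primrec.const false) Primrec.snd)
    (Primrec.list_cons.comp (Primrec.list_cons.comp (Primrec.const true) Primrec.snd)
      (Primrec.const []))).to₂

/-- The number of words of length `n` satisfying `P`. -/
def countWords (P : List Bool → Bool) (n : ℕ) : ℕ :=
  (((words n).map P).filter fun b => b = true).length

theorem computable_countWords {β : Type*} [Primcodable β] {P : β → List Bool → Bool} {f : β → ℕ}
    (hP : Computable fun x : β × List Bool => P x.1 x.2) (hf : Computable f) :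
    Computable fun b => countWords (P b) (f b) := by
  have h1 : Computable fun l : List Bool => l.filter fun b => b = true :=
    (Primrec.listFilter (Primrec.eq.comp Primrec.id (Primrec.const true))).to_comp
  unfold countWords
  exact ComputableFun.list_length (h1.comp (ComputableFun.list_map (by fun_prop) hP))

theorem countWords_eq_card (P : List Bool → Bool) (n : ℕ) :
    countWords P n = ((words n).toFinset.filter fun w => P w = true).card := by
  rw [countWords, ← List.toFinset_filter, List.toFinset_card_of_nodup ((nodup_words n).filter _),
    List.filter_map, List.length_map]
  simp [Function.comp_def]

instance : IsProbabilityMeasure cantorMeasure := by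
  have : IsProbabilityMeasure (PMF.uniformOfFintype Bool).toMeasure :=
    PMF.toMeasure.isProbabilityMeasure _
  unfold cantorMeasure
  infer_instance

theorem cylinder_eq_pi {n : ℕ} {w : List Bool} (hw : w.length = n) :
    {x : Cantor | initSeg x n = w} =
      Set.pi (Finset.range n : Set ℕ) fun i => {w.getD i false} := by
  ext x
  subst hw
  simp only [Set.mem_ofPred_eq, Set.mem_pi, Finset.coe_range, Set.mem_Iio, Set.mem_singleton_iff]
  rw [eq_comm, eq_initSeg_iff]
  exact forall₂_congr fun i hi => by
    rw [List.getD_eq_getElem _ _ hi, eq_comm]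

theorem measurableSet_cylinder {n : ℕ} {w : List Bool} (hw : w.length = n) :
    MeasurableSet {x : Cantor | initSeg x n = w} := by
  rw [cylinder_eq_pi hw]
  exact MeasurableSet.pi (Finset.countable_toSet _) fun _ _ => MeasurableSet.singleton _

theorem cantorMeasure_cylinder {n : ℕ} {w : List Bool} (hw : w.length = n) :
    cantorMeasure {x | initSeg x n = w} = 2⁻¹ ^ n := by
  have : IsProbabilityMeasure (PMF.uniformOfFintype Bool).toMeasure :=
    PMF.toMeasure.isProbabilityMeasure _
  rw [cylinder_eq_pi hw, cantorMeasure, Measure.infinitePi_pi _ fun _ _ => MeasurableSet.singleton _]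
  rw [Finset.prod_congr rfl (g := fun _ => (2⁻¹ : ℝ≥0∞)), Finset.prod_const, Finset.card_range]
  intro i _
  rw [PMF.toMeasure_apply_singleton _ _ (MeasurableSet.singleton _)]
  simp

theorem setOf_initSeg_eq_biUnion (P : List Bool → Bool) (n : ℕ) :
    {x : Cantor | P (initSeg x n) = true} =
      ⋃ w ∈ (words n).toFinset.filter fun w => P w = true, {x : Cantor | initSeg x n = w} := by
  ext x
  simp [mem_words]

theorem measurableSet_setOf_initSeg (P : List Bool → Bool) (n : ℕ) :
    MeasurableSet {x : Cantor | P (initSeg x n) = true} := by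
  rw [setOf_initSeg_eq_biUnion]
  refine Finset.measurableSet_biUnion _ fun w hw => measurableSet_cylinder ?_
  simpa [mem_words] using (Finset.mem_filter.1 hw).1

theorem cantorMeasure_setOf_initSeg (P : List Bool → Bool) (n : ℕ) :
    cantorMeasure {x | P (initSeg x n) = true} = countWords P n * 2⁻¹ ^ n := by
  have hlen : ∀ w ∈ (words n).toFinset.filter fun w => P w = true, w.length = n := fun w hw => by
    simpa [mem_words] using (Finset.mem_filter.1 hw).1
  rw [setOf_initSeg_eq_biUnion, measure_biUnion_finset ?_ fun w hw =>
    measurableSet_cylinder (hlen w hw), Finset.sum_congr rfl fun w hw =>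
    cantorMeasure_cylinder (hlen w hw), Finset.sum_const, countWords_eq_card, nsmul_eq_mul]
  intro w _ w' _ hne
  refine Set.disjoint_left.2 fun x hx hx' => hne ?_
  exact Eq.trans (Eq.symm hx) hx'

theorem two_pow_le_iff (c k n : ℕ) :
    2 ^ n ≤ c * 2 ^ k ↔ (2⁻¹ : ℝ≥0∞) ^ k ≤ c * 2⁻¹ ^ n := by
  have h2 : ∀ m : ℕ, (2 : ℝ≥0∞) ^ m ≠ 0 := fun m => pow_ne_zero _ two_ne_zero
  have h2' : ∀ m : ℕ, (2 : ℝ≥0∞) ^ m ≠ ⊤ := fun m => ENNReal.pow_ne_top ENNReal.ofNat_ne_top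
  rw [← ENNReal.inv_pow, ← ENNReal.inv_pow, ← div_eq_mul_inv,
    ENNReal.le_div_iff_mul_le (Or.inl (h2 n)) (Or.inl (h2' n)),
    mul_comm ((2 ^ k : ℝ≥0∞)⁻¹), ← div_eq_mul_inv,
    ENNReal.div_le_iff_le_mul (Or.inl (h2 k)) (Or.inl (h2' k))]
  exact_mod_cast Iff.rfl

/-- A closed set of positive measure is approximated by a positive proportion of the words. -/
theorem exists_le_countWords {P : List Bool → Bool}
    (h : 0 < cantorMeasure {x | ∀ n, P (initSeg x n) = true}) :
    ∃ k, ∀ n, 2 ^ n ≤ countWords P n * 2 ^ k := by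
  obtain ⟨k, hk⟩ := ENNReal.exists_inv_two_pow_lt h.ne'
  refine ⟨k, fun n => (two_pow_le_iff _ _ _).2 ?_⟩
  rw [← cantorMeasure_setOf_initSeg]
  exact hk.le.trans (measure_mono fun x hx => hx n)

theorem cantorMeasure_pos_of_le_countWords {P : List Bool → Bool}
    (hP : ∀ v w, v <+: w → P w = true → P v = true) {k : ℕ}
    (h : ∀ n, 2 ^ n ≤ countWords P n * 2 ^ k) :
    0 < cantorMeasure {x | ∀ n, P (initSeg x n) = true} := by
  have hset : {x : Cantor | ∀ n, P (initSeg x n) = true} =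
      ⋂ n, {x : Cantor | P (initSeg x n) = true} := by
    ext x
    simp
  have hanti : Antitone fun n => {x : Cantor | P (initSeg x n) = true} :=
    fun m n hmn x hx => hP _ _ (initSeg_prefix x hmn) hx
  have := tendsto_measure_iInter_atTop (μ := cantorMeasure)
    (fun n => (measurableSet_setOf_initSeg P n).nullMeasurableSet) hanti
    ⟨0, measure_ne_top _ _⟩
  rw [hset]
  refine lt_of_lt_of_le ?_ (ge_of_tendsto' this (b := 2⁻¹ ^ k) fun n => ?_)
  · exact ENNReal.pow_pos (ENNReal.inv_pos.2 ENNReal.ofNat_ne_top) k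
  · rw [Function.comp_apply, cantorMeasure_setOf_initSeg]
    exact (two_pow_le_iff _ _ _).1 (h n)

/-- Prepending a word preserves positive measure. -/
theorem cantorMeasure_pos_of_shift {P : List Bool → Bool}
    (hP : ∀ v w, v <+: w → P w = true → P v = true) {k : ℕ}
    (h : ∀ n, 2 ^ n ≤ countWords P n * 2 ^ k) (w : List Bool) :
    0 < cantorMeasure {x | ∀ n, (initSeg x n).take w.length = w.take n ∧
      P ((initSeg x n).drop w.length) = true} := by
  let Q : List Bool → Bool := fun v =>
    decide (v.take w.length = w.take v.length) && P (v.drop w.length)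
  have hQ : ∀ v v', v <+: v' → Q v' = true → Q v = true := by
    rintro v v' ⟨t, rfl⟩ hv
    simp only [Q, Bool.and_eq_true, decide_eq_true_eq] at hv ⊢
    refine ⟨?_, hP _ _ ?_ hv.2⟩
    · have := congrArg (List.take v.length) hv.1
      rw [List.take_take, List.take_take, ← List.take_take, List.length_append,
        min_eq_left (by omega : v.length ≤ v.length + t.length)] at this
      rw [← this, List.take_take, min_comm, ← List.take_take, List.take_left]
    · rw [List.drop_append]
      exact List.prefix_append _ _
  have hcount : ∀ n, 2 ^ n ≤ countWords Q n * 2 ^ (k + w.length) := by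
    intro n
    by_cases hn : n ≤ w.length
    · have : 1 ≤ countWords Q n := by
        rw [countWords_eq_card, Nat.succ_le_iff, Finset.card_pos]
        refine ⟨w.take n, ?_⟩
        have hnil : P [] = true := by
          have h0 := h 0
          by_contra hne
          simp [countWords, words, hne] at h0
        have h1 : (w.take n).drop w.length = [] := List.drop_eq_nil_of_le (by simp)
        simp [mem_words, hn, Q, h1, hnil, List.take_take]
      calc 2 ^ n ≤ 1 * 2 ^ (k + w.length) := by
            rw [one_mul]; exact Nat.pow_le_pow_right two_pos (by omega)
        _ ≤ _ := Nat.mul_le_mul_right _ this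
    · have hle : countWords P (n - w.length) ≤ countWords Q n := by
        rw [countWords_eq_card, countWords_eq_card]
        refine Finset.card_le_card_of_injOn (fun v => w ++ v) (fun v hv => ?_)
          fun v _ v' _ h => List.append_cancel_left h
        simp only [Finset.coe_filter, List.mem_toFinset, mem_words, Set.mem_ofPred_eq] at hv ⊢
        refine ⟨by rw [List.length_append]; omega, ?_⟩
        simp [Q, hv.2]
      calc 2 ^ n = 2 ^ (n - w.length) * 2 ^ w.length := by rw [← pow_add]; congr 1; omega
        _ ≤ countWords P (n - w.length) * 2 ^ k * 2 ^ w.length :=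
            Nat.mul_le_mul_right _ (h _)
        _ = countWords P (n - w.length) * 2 ^ (k + w.length) := by rw [pow_add, mul_assoc]
        _ ≤ _ := Nat.mul_le_mul_right _ hle
  refine (cantorMeasure_pos_of_le_countWords hQ hcount).trans_le (measure_mono fun x hx n => ?_)
  simpa [Q] using hx n

end CantorMeasure

/-! ### Separating discrete from probabilistic advice -/

section Separation

/-- The information on a point of Cantor space: its prefixes. -/
def cantorInfo (x : Cantor) (s : ℕ) : List Bool := initSeg x s

variable (alive : List ℕ × ℕ × List Bool → Bool)

/-- The advice is alive at all stages up to the one given by the lengths of the words. -/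
def aliveUpTo (a : List ℕ × ℕ × List Bool) : Bool :=
  (List.range (min a.1.length a.2.2.length + 1)).all fun m =>
    alive (a.1.take m, a.2.1, a.2.2.take m)

/-- The guess `j = ⟨n, k⟩`, that the advice in the `n`-th copy of Cantor space has measure at least
`2⁻ᵏ`, is refuted by the word. -/
def refuted (a : List ℕ × ℕ) : Bool :=
  decide (countWords (fun v => aliveUpTo alive (a.1, a.2.unpair.1, v)) a.1.length *
    2 ^ a.2.unpair.2 < 2 ^ a.1.length)

/-- A word alive at the previous stage, provided that there is one. -/
def aliveWord (a : List ℕ × ℕ) : List Bool :=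
  (words (a.1.length - 1)).getD (((words (a.1.length - 1)).map fun v =>
    aliveUpTo alive (a.1.take (a.1.length - 1), a.2, v)).findIdx fun b => b) []

/-- The current guess at stage `s` and the cylinder in which it is followed. When a guess is
refuted, the next guess is followed in a cylinder that has not been removed so far. -/
def guessAt (σ : List ℕ) (s : ℕ) : ℕ × List Bool :=
  Nat.rec (0, []) (fun s g => if refuted alive (σ.take s, g.1) = true then
    (g.1 + 1, g.2 ++ aliveWord alive (σ.take s, g.1.unpair.1)) else g) s

/-- The current guess on a word. -/
def guess (σ : List ℕ) : ℕ × List Bool := guessAt alive σ σ.length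

/-- Probabilistic advice is alive if it lies in the current cylinder and, as long as the current
guess is not refuted, follows this guess. -/
def shiftedAlive (a : List ℕ × List Bool) : Bool :=
  decide (a.2.take (guess alive a.1).2.length = (guess alive a.1).2.take a.2.length) &&
    (refuted alive (a.1, (guess alive a.1).1) ||
      aliveUpTo alive (a.1, (guess alive a.1).1.unpair.1, a.2.drop (guess alive a.1).2.length))

/-- The stage `t` is alive as long as the guess at stage `t` is not refuted afterwards. -/
def stageAlive (a : List ℕ × ℕ) : Bool :=
  decide (a.1.length < a.2) || !refuted alive (a.1, (guess alive (a.1.take a.2)).1)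

section Computability

variable {alive}

theorem computable_aliveUpTo (ha : Computable alive) : Computable (aliveUpTo alive) := by
  unfold aliveUpTo; fun_prop

theorem computable_refuted (ha : Computable alive) : Computable (refuted alive) := by
  have h := computable_aliveUpTo ha
  have : Computable fun a : List ℕ × ℕ =>
      countWords (fun v => aliveUpTo alive (a.1, a.2.unpair.1, v)) a.1.length :=
    computable_countWords (by fun_prop) (by fun_prop)
  unfold refuted
  fun_prop

theorem computable_aliveWord (ha : Computable alive) : Computable (aliveWord alive) := by
  have h := computable_aliveUpTo ha
  have h1 : Computable fun l : List Bool => l.findIdx fun b => b :=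
    (Primrec.list_findIdx Primrec.id Primrec₂.right).to_comp
  have h2 : Computable fun a : List ℕ × ℕ => (words (a.1.length - 1)).map fun v =>
      aliveUpTo alive (a.1.take (a.1.length - 1), a.2, v) := by fun_prop
  unfold aliveWord
  exact ComputableFun.list_getD _ (by fun_prop) (h1.comp h2)

theorem computable_guess (ha : Computable alive) : Computable (guess alive) := by
  have h := computable_refuted ha
  have h' := computable_aliveWord ha
  refine ComputableFun.nat_rec (by fun_prop) (by fun_prop) ?_
  have h3 : Computable fun x : List ℕ × ℕ × ℕ × List Bool =>
      decide (refuted alive (x.1.take x.2.1, x.2.2.1) = true) :=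
    Computable.of_eq (f := fun x : List ℕ × ℕ × ℕ × List Bool =>
      refuted alive (x.1.take x.2.1, x.2.2.1)) (by fun_prop) fun x => by simp
  fun_prop

theorem computable_shiftedAlive (ha : Computable alive) : Computable (shiftedAlive alive) := by
  have h := computable_refuted ha
  have h' := computable_guess ha
  have h'' := computable_aliveUpTo ha
  unfold shiftedAlive
  fun_prop

theorem computable_stageAlive (ha : Computable alive) : Computable (stageAlive alive) := by
  have h := computable_refuted ha
  have h' := computable_guess ha
  unfold stageAlive
  fun_prop

end Computability

variable {alive}

theorem aliveUpTo_iff {p : Baire} {s n : ℕ} {v : List Bool} :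
    aliveUpTo alive (initSeg p s, n, v) = true ↔
      ∀ m ≤ s, m ≤ v.length → alive (initSeg p m, n, v.take m) = true := by
  simp only [aliveUpTo, List.all_eq_true, List.mem_range, length_initSeg, take_initSeg]
  constructor
  · intro h m hs hv
    simpa [min_eq_left hs] using h m (by omega)
  · intro h m hm
    rw [min_eq_left (by omega)]
    exact h m (by omega) (by omega)

theorem aliveUpTo_mono {p : Baire} {s s' n : ℕ} {v v' : List Bool} (hs : s ≤ s') (hv : v <+: v')
    (h : aliveUpTo alive (initSeg p s', n, v') = true) :
    aliveUpTo alive (initSeg p s, n, v) = true := by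
  rw [aliveUpTo_iff] at h ⊢
  intro m hm hmv
  have := h m (hm.trans hs) (hmv.trans hv.length_le)
  obtain ⟨t, rfl⟩ := hv
  rwa [List.take_append_of_le_length hmv] at this

theorem guessAt_succ (σ : List ℕ) (s : ℕ) : guessAt alive σ (s + 1) =
    if refuted alive (σ.take s, (guessAt alive σ s).1) = true then
      ((guessAt alive σ s).1 + 1, (guessAt alive σ s).2 ++
        aliveWord alive (σ.take s, (guessAt alive σ s).1.unpair.1))
    else guessAt alive σ s := rfl

theorem guessAt_congr {σ τ : List ℕ} {i : ℕ} (h : ∀ m < i, σ.take m = τ.take m) :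
    guessAt alive σ i = guessAt alive τ i := by
  induction i with
  | zero => rfl
  | succ i ih =>
    rw [guessAt_succ, guessAt_succ, ih fun m hm => h m (by omega), h i (by omega)]

theorem guess_succ (p : Baire) (s : ℕ) : guess alive (initSeg p (s + 1)) =
    if refuted alive (initSeg p s, (guess alive (initSeg p s)).1) = true then
      ((guess alive (initSeg p s)).1 + 1, (guess alive (initSeg p s)).2 ++
        aliveWord alive (initSeg p s, (guess alive (initSeg p s)).1.unpair.1))
    else guess alive (initSeg p s) := by
  have h1 : guessAt alive (initSeg p (s + 1)) s = guess alive (initSeg p s) := by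
    rw [guess, length_initSeg]
    refine guessAt_congr fun m hm => ?_
    rw [take_initSeg, take_initSeg, min_eq_left (by omega), min_eq_left (by omega)]
  have h2 : (initSeg p (s + 1)).take s = initSeg p s := by
    rw [take_initSeg, min_eq_left (by omega)]
  rw [← h1]
  conv_rhs => rw [← h2]
  rw [guess, length_initSeg]
  rfl

theorem guess_fst_mono (p : Baire) : Monotone fun s => (guess alive (initSeg p s)).1 :=
  monotone_nat_of_le_succ fun s => by
    rw [guess_succ]
    split_ifs <;> simp

theorem not_refuted_of_guess_eq {p : Baire} {r s : ℕ} (hrs : r < s)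
    (h : (guess alive (initSeg p r)).1 = (guess alive (initSeg p s)).1) :
    refuted alive (initSeg p r, (guess alive (initSeg p r)).1) = false := by
  by_contra hne
  rw [Bool.not_eq_false] at hne
  have h1 := guess_fst_mono (alive := alive) p (Nat.succ_le_of_lt hrs)
  have h2 := guess_succ (alive := alive) p r
  rw [if_pos hne] at h2
  simp only [Nat.succ_eq_add_one, h2] at h1
  omega

theorem guess_le_of_not_refuted {p : Baire} {j : ℕ}
    (h : ∀ s, refuted alive (initSeg p s, j) = false) (s : ℕ) :
    (guess alive (initSeg p s)).1 ≤ j := by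
  induction s with
  | zero => exact Nat.zero_le _
  | succ s ih =>
    rw [guess_succ]
    split_ifs with hr
    · refine Nat.succ_le_of_lt (lt_of_le_of_ne ih fun he => ?_)
      rw [he, h s] at hr
      exact absurd hr (by simp)
    · exact ih

theorem exists_final_stage {p : Baire} {j : ℕ}
    (h : ∀ s, refuted alive (initSeg p s, j) = false) :
    ∃ t, ∀ s ≥ t, refuted alive (initSeg p s, (guess alive (initSeg p t)).1) = false := by
  let d : ℕ → ℕ := fun s => j - (guess alive (initSeg p s)).1
  obtain ⟨t, ht⟩ : ∃ t, ∀ s, d t ≤ d s := ⟨_, fun s => Function.argmin_le d s⟩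
  refine ⟨t, fun s hs => ?_⟩
  have hconst : ∀ s ≥ t, (guess alive (initSeg p s)).1 =
      (guess alive (initSeg p t)).1 := fun s hs => by
    have h1 := ht s
    have h2 := guess_fst_mono (alive := alive) p hs
    have h3 := guess_le_of_not_refuted h s
    simp only [d] at h1 h2
    omega
  rw [← hconst s hs]
  exact not_refuted_of_guess_eq (Nat.lt_succ_self s)
    ((hconst s hs).trans (hconst (s + 1) (by omega)).symm)

theorem guess_eq_of_not_refuted {p : Baire} {t : ℕ}
    (h : ∀ s ≥ t, refuted alive (initSeg p s, (guess alive (initSeg p t)).1) = false) {s : ℕ}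
    (hs : t ≤ s) : guess alive (initSeg p s) = guess alive (initSeg p t) := by
  induction s, hs using Nat.le_induction with
  | base => rfl
  | succ s hs ih => rw [guess_succ, ih, h s hs]; simp

theorem mem_survivors_stageAlive {p : Baire} {t : ℕ} :
    t ∈ survivors natInfo (stageAlive alive) p ↔
      ∀ s ≥ t, refuted alive (initSeg p s, (guess alive (initSeg p t)).1) = false := by
  simp only [survivors, natInfo, stageAlive, Set.mem_ofPred_eq, length_initSeg, take_initSeg,
    Bool.or_eq_true, decide_eq_true_eq, Bool.not_eq_true']
  refine forall_congr' fun s => ?_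
  by_cases hs : s < t
  · simp [hs, not_le.2 hs]
  · rw [min_eq_left (not_lt.1 hs)]
    simp [hs, not_lt.1 hs]

theorem exists_aliveUpTo_of_not_refuted {p : Baire} {s j : ℕ}
    (h : refuted alive (initSeg p s, j) = false) :
    ∃ v : List Bool, v.length = s ∧ aliveUpTo alive (initSeg p s, j.unpair.1, v) = true := by
  rw [refuted, decide_eq_false_iff_not, not_lt, length_initSeg] at h
  have hpos : 0 < countWords (fun v => aliveUpTo alive (initSeg p s, j.unpair.1, v)) s := by
    by_contra hne
    rw [Nat.eq_zero_of_not_pos hne, zero_mul] at h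
    exact absurd h (by simp)
  rw [countWords_eq_card, Finset.card_pos] at hpos
  obtain ⟨v, hv⟩ := hpos
  simp only [Finset.mem_filter, List.mem_toFinset, mem_words] at hv
  exact ⟨v, hv⟩

theorem aliveWord_spec {p : Baire} {s j : ℕ} (h : refuted alive (initSeg p s, j) = false) :
    (aliveWord alive (initSeg p (s + 1), j.unpair.1)).length = s ∧
      aliveUpTo alive (initSeg p s, j.unpair.1,
        aliveWord alive (initSeg p (s + 1), j.unpair.1)) = true := by
  obtain ⟨v, hv, hva⟩ := exists_aliveUpTo_of_not_refuted h
  simp only [aliveWord, length_initSeg, take_initSeg, Nat.add_sub_cancel,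
    min_eq_left (Nat.le_succ s)]
  have hlt : ((words s).map fun v =>
      aliveUpTo alive (initSeg p s, j.unpair.1, v)).findIdx (fun b => b) < (words s).length := by
    have := List.findIdx_lt_length_of_exists (p := fun b : Bool => b) (xs := (words s).map fun v =>
      aliveUpTo alive (initSeg p s, j.unpair.1, v))
      ⟨true, List.mem_map.2 ⟨v, mem_words.2 hv, hva⟩, rfl⟩
    simpa using this
  rw [List.getD_eq_getElem _ _ hlt]
  refine ⟨mem_words.1 (List.getElem_mem hlt), ?_⟩
  have := List.findIdx_getElem (p := fun b : Bool => b) (xs := (words s).map fun v =>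
      aliveUpTo alive (initSeg p s, j.unpair.1, v)) (w := by simpa using hlt)
  simpa using this

theorem take_initSeg_of_initSeg_eq {y : Cantor} {w : List Bool} (h : initSeg y w.length = w)
    (r : ℕ) : (initSeg y r).take w.length = w.take r := by
  conv_rhs => rw [← h]
  rw [take_initSeg, take_initSeg, min_comm]

/-- Points in the current cylinder that have followed the current guess so far have not been
removed for an earlier guess. -/
theorem shiftedAlive_of_follows {p : Baire} (s : ℕ) (y : Cantor)
    (hy : initSeg y (guess alive (initSeg p s)).2.length = (guess alive (initSeg p s)).2)
    (hfol : ∀ r < s, guess alive (initSeg p r) = guess alive (initSeg p s) →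
      aliveUpTo alive (initSeg p r, (guess alive (initSeg p s)).1.unpair.1,
        (initSeg y r).drop (guess alive (initSeg p s)).2.length) = true) :
    ∀ r < s, shiftedAlive alive (initSeg p r, initSeg y r) = true := by
  induction s with
  | zero => intro r hr; omega
  | succ s ih =>
    have hg := guess_succ (alive := alive) p s
    by_cases href : refuted alive (initSeg p s, (guess alive (initSeg p s)).1) = true
    · rw [if_pos href] at hg
      have hy' : initSeg y (guess alive (initSeg p s)).2.length = (guess alive (initSeg p s)).2 := by
        rw [hg] at hy
        have := congrArg (List.take (guess alive (initSeg p s)).2.length) hy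
        simpa using this
      have hlast : shiftedAlive alive (initSeg p s, initSeg y s) = true := by
        simp [shiftedAlive, href, take_initSeg_of_initSeg_eq hy']
      have hprev := ih hy' fun r hr hrs => by
        obtain ⟨s', rfl⟩ : ∃ s', s = s' + 1 := ⟨s - 1, by omega⟩
        have hs' : (guess alive (initSeg p s')).1 = (guess alive (initSeg p (s' + 1))).1 := by
          refine le_antisymm (guess_fst_mono p (Nat.le_succ s')) ?_
          rw [← hrs]
          exact guess_fst_mono p (by omega)
        have hnr := not_refuted_of_guess_eq (Nat.lt_succ_self s') hs'
        rw [hs'] at hnr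
        obtain ⟨hlen, hal⟩ := aliveWord_spec hnr
        refine aliveUpTo_mono (s' := s') (by omega) ?_ hal
        rw [hg] at hy
        have hy2 := congrArg (List.drop (guess alive (initSeg p (s' + 1))).2.length) hy
        simp only [List.length_append, List.drop_left, drop_initSeg, Nat.add_sub_cancel_left,
          hlen] at hy2
        rw [drop_initSeg, ← hy2]
        exact initSeg_prefix _ (by omega)
      intro r hr
      rcases Nat.lt_succ_iff_lt_or_eq.1 hr with h | rfl
      · exact hprev r h
      · exact hlast
    · rw [if_neg href] at hg
      rw [hg] at hy hfol
      have hprev := ih hy fun r hr => hfol r (by omega)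
      intro r hr
      rcases Nat.lt_succ_iff_lt_or_eq.1 hr with h | rfl
      · exact hprev r h
      · simp [shiftedAlive, take_initSeg_of_initSeg_eq hy, hfol r hr rfl]

theorem countWords_congr {P Q : List Bool → Bool} {n : ℕ}
    (h : ∀ v : List Bool, v.length = n → P v = Q v) : countWords P n = countWords Q n := by
  unfold countWords
  rw [List.map_congr_left fun v hv => h v (mem_words.1 hv)]

/-- The words that follow the guess with number component `n`. -/
def follows (alive : List ℕ × ℕ × List Bool → Bool) (p : Baire) (n : ℕ) (v : List Bool) : Bool :=
  aliveUpTo alive (initSeg p v.length, n, v)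

theorem refuted_iff {p : Baire} {s j : ℕ} : refuted alive (initSeg p s, j) = false ↔
    2 ^ s ≤ countWords (follows alive p j.unpair.1) s * 2 ^ j.unpair.2 := by
  rw [refuted, decide_eq_false_iff_not, not_lt, length_initSeg,
    countWords_congr (Q := follows alive p j.unpair.1) fun v hv => by rw [follows, hv]]

theorem follows_of_prefix {p : Baire} {n : ℕ} (v v' : List Bool) (h : v <+: v')
    (h' : follows alive p n v' = true) : follows alive p n v = true :=
  aliveUpTo_mono h.length_le h h'

theorem cantorMeasure_survivors_pos {p : Baire} {t : ℕ}
    (h : ∀ s ≥ t, refuted alive (initSeg p s, (guess alive (initSeg p t)).1) = false) :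
    0 < cantorMeasure (survivors cantorInfo (shiftedAlive alive) p) := by
  set j := (guess alive (initSeg p t)).1 with hj
  set w := (guess alive (initSeg p t)).2 with hw
  have hcount : ∀ n, 2 ^ n ≤ countWords (follows alive p j.unpair.1) n *
      2 ^ (j.unpair.2 + t) := by
    intro n
    by_cases hn : t ≤ n
    · refine (refuted_iff.1 (h n hn)).trans (Nat.mul_le_mul_left _ ?_)
      exact Nat.pow_le_pow_right two_pos (by omega)
    · have : 1 ≤ countWords (follows alive p j.unpair.1) n := by
        rw [countWords_eq_card, Nat.succ_le_iff, Finset.card_pos]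
        obtain ⟨v, hv, hva⟩ := exists_aliveUpTo_of_not_refuted (h t le_rfl)
        refine ⟨v.take n, ?_⟩
        have hfv : follows alive p j.unpair.1 v = true := by rwa [follows, hv]
        have hlen : n ≤ t := by omega
        simp [mem_words, hv, hlen, follows_of_prefix _ _ (List.take_prefix n v) hfv]
      calc 2 ^ n ≤ 1 * 2 ^ (j.unpair.2 + t) := by
            rw [one_mul]; exact Nat.pow_le_pow_right two_pos (by omega)
        _ ≤ _ := Nat.mul_le_mul_right _ this
  refine (cantorMeasure_pos_of_shift follows_of_prefix hcount w).trans_le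
    (measure_mono fun y hy => ?_)
  have hfol : ∀ r, aliveUpTo alive (initSeg p r, j.unpair.1, (initSeg y r).drop w.length) = true := by
    intro r
    have := (hy (w.length + r)).2
    rw [drop_initSeg, follows, length_initSeg, Nat.add_sub_cancel_left] at this
    refine aliveUpTo_mono le_rfl ?_ this
    rw [drop_initSeg]
    exact initSeg_prefix _ (by omega)
  have hyw : initSeg y w.length = w := by
    have := (hy w.length).1
    simpa using this
  intro r
  by_cases hr : r < t
  · exact shiftedAlive_of_follows t y hyw (fun r _ _ => hfol r) r hr
  · have hg := guess_eq_of_not_refuted h (not_lt.1 hr)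
    simp only [cantorInfo, shiftedAlive, hg, ← hj, ← hw, hfol r, take_initSeg_of_initSeg_eq hyw,
      length_initSeg]
    simp

theorem aliveUpTo_of_mem_survivors {p : Baire} {t : ℕ}
    (h : ∀ s ≥ t, refuted alive (initSeg p s, (guess alive (initSeg p t)).1) = false) {y : Cantor}
    (hy : y ∈ survivors cantorInfo (shiftedAlive alive) p) (m : ℕ) :
    alive (initSeg p m, (guess alive (initSeg p t)).1.unpair.1,
      initSeg (fun i => y ((guess alive (initSeg p t)).2.length + i)) m) = true := by
  have h1 := hy (t + (guess alive (initSeg p t)).2.length + m)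
  have hle : t ≤ t + (guess alive (initSeg p t)).2.length + m := by omega
  have hg := guess_eq_of_not_refuted h hle
  simp only [cantorInfo, shiftedAlive, hg, h _ hle, Bool.false_or, Bool.and_eq_true] at h1
  have h2 := aliveUpTo_iff.1 h1.2 m (by omega) (by simp; omega)
  rwa [drop_initSeg, take_initSeg, min_eq_left (by omega)] at h2

variable {X : Type u} {Y : Type v} [Represented X] [Represented Y]

/-- Discrete and probabilistic advice can be made independent of each other. -/
theorem Solvable.parallelSolvable {f : MultiFun X Y}
    (h : Solvable (prodInfo natInfo cantorInfo)
      (fun S => ∃ n, 0 < cantorMeasure {x | (n, x) ∈ S}) f) :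
    ParallelSolvable natInfo Set.Nonempty cantorInfo (fun S => 0 < cantorMeasure S) f := by
  obtain ⟨alive, out, ha, ho, h⟩ := h
  have hg := computable_guess ha
  have hs := computable_shiftedAlive ha
  have ht := computable_stageAlive ha
  have hout : Computable fun a : List ℕ × ℕ × List Bool => if a.1.length < a.2.1 then [] else
      out (a.1.take (a.2.2.length - (guess alive (a.1.take a.2.1)).2.length),
        (guess alive (a.1.take a.2.1)).1.unpair.1,
        a.2.2.drop (guess alive (a.1.take a.2.1)).2.length) := by
    have h1 : Computable fun a : List ℕ × ℕ × List Bool => guess alive (a.1.take a.2.1) := by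
      fun_prop
    have h2 : Computable fun a : List ℕ × ℕ × List Bool => a.2.2 := by fun_prop
    have h3 : Computable fun a : List ℕ × ℕ × List Bool =>
        (guess alive (a.1.take a.2.1)).2.length := by fun_prop
    have h4 : Computable fun a : List ℕ × ℕ × List Bool =>
        (guess alive (a.1.take a.2.1)).1.unpair.1 := by fun_prop
    exact ComputableFun.ite (by fun_prop) (Computable.const _) (ho.comp
      ((ComputableFun.list_take (ComputableFun.nat_sub (ComputableFun.list_length h2) h3)
        Computable.fst).pair (h4.pair (ComputableFun.list_drop h3 h2))))
  refine ⟨stageAlive alive, shiftedAlive alive, _, ht, hs, hout, fun p x hx hd => ?_⟩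
  obtain ⟨⟨n, hn⟩, h⟩ := h p x hx hd
  obtain ⟨t₀, ht₀⟩ : ∃ t, ∀ s ≥ t,
      refuted alive (initSeg p s, (guess alive (initSeg p t)).1) = false := by
    have hpos : 0 < cantorMeasure {x | ∀ s, follows alive p n (initSeg x s) = true} := by
      refine hn.trans_le (measure_mono fun y hy s => ?_)
      rw [follows, length_initSeg, aliveUpTo_iff]
      intro m hm _
      rw [take_initSeg, min_eq_left hm]
      exact hy m
    obtain ⟨k, hk⟩ := exists_le_countWords hpos
    refine exists_final_stage (j := Nat.pair n k) fun s => refuted_iff.2 ?_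
    simpa using hk s
  refine ⟨⟨t₀, mem_survivors_stageAlive.2 ht₀⟩, cantorMeasure_survivors_pos ht₀,
    fun t ht y hy => ?_⟩
  have ht' := mem_survivors_stageAlive.1 ht
  obtain ⟨q, hq, hsol⟩ := h ((guess alive (initSeg p t)).1.unpair.1,
    fun i => y ((guess alive (initSeg p t)).2.length + i)) (aliveUpTo_of_mem_survivors ht' hy)
  refine ⟨q, ?_, hsol⟩
  simp only [length_initSeg, natInfo, cantorInfo, take_initSeg]
  refine (hq.comp_tendsto (tendsto_sub_atTop_nat (guess alive (initSeg p t)).2.length)).ite_nil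
    fun k hk => ?_
  rw [min_eq_left hk, min_eq_left (by omega), drop_initSeg]
  rfl

end Separation

/-! ### Codings of the advice spaces -/

section Codings

theorem truncatable_natInfo : Truncatable natInfo :=
  ⟨fun a => a.2, by fun_prop, fun _ _ _ _ => rfl⟩

theorem truncatable_cantorInfo : Truncatable cantorInfo :=
  ⟨fun a => a.2.take a.1, by fun_prop, fun x m s h => by
    simp [cantorInfo, min_eq_left h]⟩

theorem approx_initSeg_comp (p : Baire) {m : ℕ → ℕ} (hm : Tendsto m atTop atTop) :
    Approx (fun s => initSeg p (m s)) p :=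
  (approx_initSeg p).comp_tendsto hm

/-- The bits of a word at the positions given by `pos`. -/
def bits (pos : ℕ → ℕ) (τ : List ℕ) : List Bool :=
  (List.range (τ.length / 2)).map fun i => decide (τ.getD (pos i) 0 = 1)

theorem computable_bits {pos : ℕ → ℕ} (h : Computable pos) : Computable (bits pos) := by
  unfold bits; fun_prop

theorem bits_initSeg {pos : ℕ → ℕ} {t : Baire} {x : Cantor} (s : ℕ)
    (hpos : ∀ i < s, pos i < 2 * s + 1) (h : ∀ i, t (pos i) = (x i).toNat) :
    bits pos (initSeg t (2 * s + 1)) = initSeg x s := by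
  rw [bits, length_initSeg, show (2 * s + 1) / 2 = s by omega, initSeg]
  refine List.map_congr_left fun i hi => ?_
  rw [List.mem_range] at hi
  rw [show List.map t (List.range (2 * s + 1)) = initSeg t (2 * s + 1) from rfl,
    getD_initSeg t (hpos i hi), h]
  cases x i <;> rfl

theorem mem_rep_nat {n : ℕ} {t : Baire} : n ∈ Represented.δ (X := ℕ) t ↔ t 0 = n := by
  change n ∈ Part.some (t 0) ↔ _
  rw [Part.mem_some_iff, eq_comm]

theorem mem_rep_cantor {x : Cantor} {t : Baire} :
    x ∈ Represented.δ (X := Cantor) t ↔ t = cantorToBaire x := by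
  constructor
  · rintro ⟨h, rfl⟩
    funext n
    have : t n < 2 := h n
    change t n = (decide (t n = 1)).toNat
    interval_cases t n <;> rfl
  · rintro rfl
    refine ⟨fun n => ?_, ?_⟩
    · cases h : x n <;> simp [cantorToBaire, h]
    · funext n
      change decide (cantorToBaire x n = 1) = x n
      cases h : x n <;> simp [cantorToBaire, h]

theorem mem_rep_prod {X : Type u} {Y : Type v} [Represented X] [Represented Y] {a : X × Y}
    {t : Baire} : a ∈ Represented.δ (X := X × Y) t ↔
      a.1 ∈ Represented.δ (X := X) (unpairFst t) ∧ a.2 ∈ Represented.δ (X := Y) (unpairSnd t) := by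
  change a ∈ (Represented.δ (X := X) (unpairFst t)).bind (fun x =>
    (Represented.δ (X := Y) (unpairSnd t)).map fun y => (x, y)) ↔ _
  simp only [Part.mem_bind_iff, Part.mem_map_iff]
  constructor
  · rintro ⟨x, hx, y, hy, rfl⟩
    exact ⟨hx, hy⟩
  · rintro ⟨hx, hy⟩
    exact ⟨a.1, hx, a.2, hy, rfl⟩

theorem nameCoding_natInfo : NameCoding natInfo fun r t => r ∈ Represented.δ (X := ℕ) t where
  exists_enc := ⟨fun a => (List.range a.1).map fun _ => a.2, by fun_prop, fun n =>
    ⟨fun _ => n, mem_rep_nat.2 rfl, approx_initSeg fun _ => n⟩⟩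
  exists_dec := ⟨fun τ => τ.getD 0 0, by fun_prop, fun n t h s => by
    beta_reduce
    rw [getD_initSeg t (by omega), mem_rep_nat.1 h, natInfo]⟩

theorem nameCoding_cantorInfo : NameCoding cantorInfo fun x t => t = cantorToBaire x where
  exists_enc := ⟨fun a => a.2.map Bool.toNat, by fun_prop, fun x =>
    ⟨_, rfl, by
      simp only [cantorInfo, map_initSeg]
      exact approx_initSeg _⟩⟩
  exists_dec := ⟨bits id, computable_bits (by fun_prop), fun x t h s => by
    subst h
    exact bits_initSeg s (fun i hi => by simp; omega) fun i => rfl⟩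

theorem nameCoding_cantorInfo_rep :
    NameCoding cantorInfo fun x t => x ∈ Represented.δ (X := Cantor) t := by
  simpa only [mem_rep_cantor] using nameCoding_cantorInfo

theorem nameCoding_natCantorInfo :
    NameCoding (prodInfo natInfo cantorInfo) fun a t => t = natCantorToBaire a where
  exists_enc := ⟨fun a => a.2.1 :: a.2.2.map Bool.toNat, by fun_prop, fun a =>
    ⟨_, rfl, by
      have : ∀ s, (prodInfo natInfo cantorInfo a s).1 ::
          (prodInfo natInfo cantorInfo a s).2.map Bool.toNat =
            initSeg (natCantorToBaire a) (s + 1) := fun s => by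
        simp only [prodInfo, natInfo, cantorInfo, map_initSeg]
        simp [initSeg, List.range_succ_eq_map, natCantorToBaire, Function.comp_def]
      simp only [this]
      exact approx_initSeg_comp _ (tendsto_add_atTop_nat 1)⟩⟩
  exists_dec := ⟨fun τ => (τ.getD 0 0, bits (fun i => i + 1) τ), by
      have := computable_bits (pos := fun i => i + 1) (by fun_prop)
      fun_prop, fun a t h s => by
    subst h
    beta_reduce
    rw [getD_initSeg _ (by omega), bits_initSeg (pos := fun i => i + 1) (x := a.2) s
      (fun i hi => by omega) fun i => rfl]
    rfl⟩

theorem nameCoding_natCantorInfo_rep : NameCoding (prodInfo natInfo cantorInfo)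
    fun a t => a ∈ Represented.δ (X := ℕ × Cantor) t where
  exists_enc := ⟨fun a => interleave ((List.range a.1).map fun _ => a.2.1)
      (a.2.2.map Bool.toNat), by
        have h1 : Computable fun a : ℕ × ℕ × List Bool => (List.range a.1).map fun _ => a.2.1 := by
          fun_prop
        have h2 : Computable fun a : ℕ × ℕ × List Bool => a.2.2.map Bool.toNat := by fun_prop
        exact computable_interleave h1 h2, fun a =>
    ⟨pair (fun _ => a.1) (cantorToBaire a.2), mem_rep_prod.2 (by
      rw [unpairFst_pair, unpairSnd_pair, mem_rep_nat, mem_rep_cantor]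
      exact ⟨rfl, rfl⟩), by
      simp only [prodInfo, natInfo, cantorInfo, map_initSeg]
      exact (approx_initSeg _).interleave (approx_initSeg (cantorToBaire a.2))⟩⟩
  exists_dec := ⟨fun τ => (τ.getD 0 0, bits (fun i => 2 * i + 1) τ), by
      have := computable_bits (pos := fun i => 2 * i + 1) (by fun_prop)
      fun_prop, fun a t h s => by
    obtain ⟨h1, h2⟩ := mem_rep_prod.1 h
    rw [mem_rep_nat] at h1
    rw [mem_rep_cantor] at h2
    beta_reduce
    rw [getD_initSeg _ (by omega), bits_initSeg (pos := fun i => 2 * i + 1) (t := t)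
      (x := a.2) s (fun i hi => by omega) fun i => congrFun h2 i]
    exact Prod.ext h1 rfl⟩

theorem ballCoding_natInfo : BallCoding natInfo where
  exists_cyl := ⟨fun a => a.2 + 1, by fun_prop, fun s w r => by
    constructor
    · rintro rfl
      exact ⟨r, rfl, rfl⟩
    · rintro ⟨c, hc, hr⟩
      obtain rfl : r = c := hr
      exact (Nat.succ_injective hc).symm⟩
  exists_hit := ⟨fun a => decide (a.1 = a.2 + 1), by fun_prop, fun w => by simp,
    fun _ _ _ _ _ h => h, fun c r => by
      change r = c ↔ ∃ _ : ℕ, decide (c + 1 = r + 1) = true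
      simp [eq_comm]⟩

theorem mem_cantorBall_encode {w : List Bool} {x : Cantor} :
    x ∈ cantorBall (Encodable.encode w) ↔ initSeg x w.length = w := by
  simp [cantorBall]

theorem ballCoding_cantorInfo : BallCoding cantorInfo where
  exists_cyl := ⟨fun a => if a.2.length = a.1 then Encodable.encode a.2 + 1 else 0, by fun_prop,
    fun s w x => by
      constructor
      · rintro rfl
        refine ⟨Encodable.encode (initSeg x s), by simp [cantorInfo], ?_⟩
        exact mem_cantorBall_encode.2 (by simp)
      · rintro ⟨c, hc, hx⟩
        beta_reduce at hc
        split_ifs at hc with hlen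
        obtain rfl := Nat.succ_injective hc
        have := mem_cantorBall_encode.1 hx
        simp only at hlen
        rwa [hlen] at this⟩
  exists_hit := ⟨fun a => decide (0 < a.1) && (Encodable.decode (a.1 - 1) : Option (List Bool)).elim
      false fun v => decide (a.2.take v.length = v), by
        have h1 : Computable fun a : ℕ × List Bool =>
          (Encodable.decode (a.1 - 1) : Option (List Bool)).elim
            false fun v => decide (a.2.take v.length = v) :=
          ComputableFun.option_elim (by fun_prop) (Computable.const _)
            (ComputableFun.decide_eq (ComputableFun.list_take
              (ComputableFun.list_length Computable.snd) (ComputableFun.snd Computable.fst))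
              Computable.snd)
        exact ComputableFun.bool_and (by fun_prop) h1, fun w => by simp,
    fun c x s s' hs h => by
      simp only [Bool.and_eq_true] at h ⊢
      refine ⟨h.1, ?_⟩
      have h := h.2
      cases hd : (Encodable.decode (c - 1) : Option (List Bool)) with
      | none => simp [hd] at h
      | some v =>
        simp only [hd, Option.elim_some, decide_eq_true_eq, cantorInfo, take_initSeg] at h ⊢
        have hle : v.length ≤ s := by
          have := congrArg List.length h
          rw [length_initSeg] at this
          omega
        rw [min_eq_left (hle.trans hs)]
        rwa [min_eq_left hle] at h,
    fun c x => by
      change x ∈ cantorBall c ↔ _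
      simp only [cantorBall, Set.mem_ofPred_eq, Nat.add_sub_cancel]
      cases hd : (Encodable.decode c : Option (List Bool)) with
      | none => simp
      | some v =>
        simp only [Option.mem_some_iff, exists_eq_left', Option.elim_some, cantorInfo,
          take_initSeg]
        constructor
        · intro h
          exact ⟨v.length, by simp [h]⟩
        · rintro ⟨s, h⟩
          simp only [Nat.zero_lt_succ, decide_true, Bool.true_and, decide_eq_true_eq] at h
          have := congrArg List.length h
          rw [length_initSeg] at this
          rwa [this] at h⟩

theorem BallCoding.prod {R₁ R₂ W₁ W₂ : Type} [Primcodable W₁] [Primcodable W₂]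
    [TopologicalSpace R₁] [TopologicalSpace R₂] [NumberedBasis R₁] [NumberedBasis R₂]
    {ρ₁ : R₁ → ℕ → W₁} {ρ₂ : R₂ → ℕ → W₂} (h₁ : BallCoding ρ₁) (h₂ : BallCoding ρ₂) :
    BallCoding (prodInfo ρ₁ ρ₂) := by
  have hball : ∀ c (r : R₁ × R₂), r ∈ NumberedBasis.ball c ↔
      r.1 ∈ NumberedBasis.ball c.unpair.1 ∧ r.2 ∈ NumberedBasis.ball c.unpair.2 :=
    fun c r => Iff.rfl
  obtain ⟨cyl₁, hc₁, hcyl₁⟩ := h₁.exists_cyl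
  obtain ⟨cyl₂, hc₂, hcyl₂⟩ := h₂.exists_cyl
  obtain ⟨hit₁, hh₁, hz₁, hm₁, hb₁⟩ := h₁.exists_hit
  obtain ⟨hit₂, hh₂, hz₂, hm₂, hb₂⟩ := h₂.exists_hit
  refine ⟨⟨fun a => if (decide (0 < cyl₁ (a.1, a.2.1)) && decide (0 < cyl₂ (a.1, a.2.2))) = true
      then Nat.pair (cyl₁ (a.1, a.2.1) - 1) (cyl₂ (a.1, a.2.2) - 1) + 1 else 0, ?_, ?_⟩,
    ⟨fun a => decide (0 < a.1) && (hit₁ ((a.1 - 1).unpair.1 + 1, a.2.1) &&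
      hit₂ ((a.1 - 1).unpair.2 + 1, a.2.2)), ?_, ?_, ?_, ?_⟩⟩
  · have e₁ : Computable fun a : ℕ × W₁ × W₂ => cyl₁ (a.1, a.2.1) := by fun_prop
    have e₂ : Computable fun a : ℕ × W₁ × W₂ => cyl₂ (a.1, a.2.2) := by fun_prop
    have e₃ : Computable fun b : ℕ × ℕ => if (decide (0 < b.1) && decide (0 < b.2)) = true
        then Nat.pair (b.1 - 1) (b.2 - 1) + 1 else 0 := by fun_prop
    exact e₃.comp (e₁.pair e₂)
  · rintro s ⟨w₁, w₂⟩ ⟨r₁, r₂⟩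
    simp only [prodInfo, Prod.mk.injEq, hcyl₁, hcyl₂, hball]
    constructor
    · rintro ⟨⟨c₁, hc₁, hr₁⟩, c₂, hc₂, hr₂⟩
      exact ⟨Nat.pair c₁ c₂, by simp [hc₁, hc₂], by simpa using ⟨hr₁, hr₂⟩⟩
    · rintro ⟨c, hc, hr₁, hr₂⟩
      split_ifs at hc with hpos
      simp only [Bool.and_eq_true, decide_eq_true_eq] at hpos
      obtain rfl := Nat.succ_injective hc
      rw [Nat.unpair_pair] at hr₁ hr₂
      exact ⟨⟨_, by omega, hr₁⟩, _, by omega, hr₂⟩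
  · have e₁ : Computable fun a : ℕ × W₁ × W₂ => hit₁ ((a.1 - 1).unpair.1 + 1, a.2.1) := by
      fun_prop
    have e₂ : Computable fun a : ℕ × W₁ × W₂ => hit₂ ((a.1 - 1).unpair.2 + 1, a.2.2) := by
      fun_prop
    fun_prop
  · intro w
    simp
  · intro c r s s' hs h
    simp only [prodInfo, Bool.and_eq_true] at h ⊢
    exact ⟨h.1, hm₁ _ _ _ _ hs h.2.1, hm₂ _ _ _ _ hs h.2.2⟩
  · intro c r
    rw [hball, hb₁, hb₂]
    simp only [Nat.add_sub_cancel, prodInfo, Nat.zero_lt_succ, decide_true, Bool.true_and,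
      Bool.and_eq_true]
    constructor
    · rintro ⟨⟨s₁, h₁⟩, s₂, h₂⟩
      exact ⟨max s₁ s₂, hm₁ _ _ _ _ (le_max_left _ _) h₁, hm₂ _ _ _ _ (le_max_right _ _) h₂⟩
    · rintro ⟨s, h₁, h₂⟩
      exact ⟨⟨s, h₁⟩, s, h₂⟩

end Codings

/-! ### The choice problems and the notions of computability as notions of solvability -/

section Characterizations

/-- A set of positive measure in `2^ℕ`. -/
def CantorLarge (S : Set Cantor) : Prop := 0 < cantorMeasure S

/-- A set of positive measure in `ℕ × 2^ℕ`. -/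
def NatCantorLarge (S : Set (ℕ × Cantor)) : Prop := ∃ n, 0 < cantorMeasure {x | (n, x) ∈ S}

theorem CantorLarge.nonempty {S : Set Cantor} (h : CantorLarge S) : S.Nonempty :=
  nonempty_of_measure_ne_zero (ne_of_gt h)

theorem NatCantorLarge.nonempty {S : Set (ℕ × Cantor)} (h : NatCantorLarge S) : S.Nonempty := by
  obtain ⟨n, h⟩ := h
  obtain ⟨x, hx⟩ := CantorLarge.nonempty h
  exact ⟨(n, x), hx⟩

theorem natCantorMeasure_pos_iff {S : Set (ℕ × Cantor)} :
    0 < natCantorMeasure S ↔ NatCantorLarge S := by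
  have hprod : ∀ n, natCantorMeasure ({n} ×ˢ {x | (n, x) ∈ S}) = cantorMeasure {x | (n, x) ∈ S} :=
    fun n => by rw [natCantorMeasure, Measure.prod_prod, Measure.count_singleton, one_mul]
  constructor
  · intro h
    by_contra hne
    simp only [NatCantorLarge, not_exists, not_lt, nonpos_iff_eq_zero] at hne
    refine h.ne' (measure_mono_null (t := ⋃ n, {n} ×ˢ {x | (n, x) ∈ S}) ?_
      (measure_iUnion_null fun n => by rw [hprod, hne]))
    rintro ⟨n, x⟩ hx
    exact Set.mem_iUnion.2 ⟨n, rfl, hx⟩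
  · rintro ⟨n, hn⟩
    rw [← hprod] at hn
    refine hn.trans_le (measure_mono ?_)
    rintro ⟨m, x⟩ ⟨hm, hx⟩
    obtain rfl : m = n := hm
    exact hx

theorem CN_eq : CN = largeChoice Set.Nonempty := by
  funext A
  ext n
  exact ⟨fun h => ⟨⟨n, h⟩, h⟩, fun h => h.2⟩

theorem PCCantor_eq : PCCantor = largeChoice CantorLarge := by
  funext A
  ext x
  exact and_congr_left fun _ => ⟨fun h => h.1, fun h => ⟨h, le_top⟩⟩

theorem PCNatCantor_eq : PCNatCantor = largeChoice NatCantorLarge := by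
  funext A
  ext x
  exact and_congr_left fun _ => ⟨fun h => natCantorMeasure_pos_iff.1 h.1,
    fun h => ⟨natCantorMeasure_pos_iff.2 h, le_top⟩⟩

variable {X : Type u} {Y : Type v} [Represented X] [Represented Y] {f : MultiFun X Y}

theorem wReducible_CN_iff : WReducible f CN ↔ Solvable natInfo Set.Nonempty f := by
  rw [CN_eq]
  exact ⟨WReducible.solvable ballCoding_natInfo nameCoding_natInfo,
    Solvable.wReducible ballCoding_natInfo nameCoding_natInfo fun _ h => h⟩

theorem wReducible_PCCantor_iff : WReducible f PCCantor ↔ Solvable cantorInfo CantorLarge f := by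
  rw [PCCantor_eq]
  exact ⟨WReducible.solvable ballCoding_cantorInfo nameCoding_cantorInfo_rep,
    Solvable.wReducible ballCoding_cantorInfo nameCoding_cantorInfo_rep
      fun _ h => h.nonempty⟩

theorem wReducible_PCNatCantor_iff :
    WReducible f PCNatCantor ↔ Solvable (prodInfo natInfo cantorInfo) NatCantorLarge f := by
  rw [PCNatCantor_eq]
  exact ⟨WReducible.solvable (ballCoding_natInfo.prod ballCoding_cantorInfo)
      nameCoding_natCantorInfo_rep,
    Solvable.wReducible (ballCoding_natInfo.prod ballCoding_cantorInfo)
      nameCoding_natCantorInfo_rep fun _ h => h.nonempty⟩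

theorem finiteMindChangeComputable_iff :
    FiniteMindChangeComputable f ↔ Solvable natInfo Set.Nonempty f :=
  ⟨FiniteMindChangeComputable.solvable, Solvable.finiteMindChangeComputable⟩

theorem lasVegasComputable_iff : LasVegasComputable f ↔ Solvable cantorInfo CantorLarge f := by
  have hmem : ∀ S, cantorMeasure S ∈ Set.Ioc (0 : ℝ≥0∞) 1 ↔ CantorLarge S :=
    fun S => ⟨fun h => h.1, fun h => ⟨h, prob_le_one⟩⟩
  exact ⟨fun h => (LasVegasOver.solvable nameCoding_cantorInfo h).congr_large
      fun S hS => (hmem S).1 hS,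
    fun h => (h.congr_large fun S hS => (hmem S).2 hS).lasVegasOver nameCoding_cantorInfo
      fun S hS => ((hmem S).1 hS).nonempty⟩

theorem lasVegasFiniteMindChange_iff :
    LasVegasFiniteMindChange f ↔ Solvable (prodInfo natInfo cantorInfo) NatCantorLarge f := by
  have hmem : ∀ S, natCantorMeasure S ∈ Set.Ioc (0 : ℝ≥0∞) ⊤ ↔ NatCantorLarge S :=
    fun S => ⟨fun h => natCantorMeasure_pos_iff.1 h.1,
      fun h => ⟨natCantorMeasure_pos_iff.2 h, le_top⟩⟩
  exact ⟨fun h => (LasVegasOver.solvable nameCoding_natCantorInfo h).congr_large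
      fun S hS => (hmem S).1 hS,
    fun h => (h.congr_large fun S hS => (hmem S).2 hS).lasVegasOver nameCoding_natCantorInfo
      fun S hS => ((hmem S).1 hS).nonempty⟩

/-! ### Compositions -/

theorem Solvable.comp_cantor_nat {Z : Type w} [Represented Z] {g : MultiFun Z Y} {h : MultiFun X Z}
    (hg : Solvable cantorInfo CantorLarge g) (hh : Solvable natInfo Set.Nonempty h) :
    Solvable (prodInfo natInfo cantorInfo) NatCantorLarge (g.comp h) := by
  refine hg.comp hh truncatable_cantorInfo fun S₁ S₂ h₁ h₂ => ?_
  obtain ⟨n, hn⟩ := h₁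
  exact ⟨n, (h₂ n hn).trans_le (measure_mono fun x hx => ⟨hn, hx⟩)⟩

theorem Solvable.comp_nat_cantor {Z : Type w} [Represented Z] {g : MultiFun Z Y} {h : MultiFun X Z}
    (hg : Solvable natInfo Set.Nonempty g) (hh : Solvable cantorInfo CantorLarge h) :
    Solvable (prodInfo natInfo cantorInfo) NatCantorLarge (g.comp h) := by
  refine (hg.comp hh truncatable_natInfo
    (large := fun S => NatCantorLarge (Prod.swap ⁻¹' S)) fun S₁ S₂ h₁ h₂ => ?_).transport
    Prod.swap (c := Prod.swap) (Computable.snd.pair Computable.fst) (fun _ _ => rfl) fun _ h => h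
  by_contra hne
  simp only [NatCantorLarge, not_exists, not_lt, nonpos_iff_eq_zero] at hne
  refine (ne_of_gt h₁) (measure_mono_null ?_ (measure_iUnion_null hne))
  intro x hx
  obtain ⟨n, hn⟩ := h₂ x hx
  exact Set.mem_iUnion.2 ⟨n, hx, hn⟩

theorem ParallelSolvable.solvable_natCantor
    (h : ParallelSolvable natInfo Set.Nonempty cantorInfo CantorLarge f) :
    Solvable (prodInfo natInfo cantorInfo) NatCantorLarge f := by
  refine h.solvable_prod fun S₁ S₂ h₁ h₂ => ?_
  obtain ⟨n, hn⟩ := h₁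
  exact ⟨n, LT.lt.trans_le h₂ (measure_mono fun x hx => ⟨hn, hx⟩)⟩

/-! ### The product of the choice problems -/

theorem ParallelSolvable.wReducible
    (h : ParallelSolvable natInfo Set.Nonempty cantorInfo CantorLarge f) :
    WReducible f (CN.prod PCCantor) := by
  rw [CN_eq, PCCantor_eq]
  obtain ⟨alive₁, alive₂, out, h1, h2, ho, h⟩ := h
  obtain ⟨g₁, hg₁, hn₁⟩ := ballCoding_natInfo.exists_name h1
  obtain ⟨g₂, hg₂, hn₂⟩ := ballCoding_cantorInfo.exists_name h2
  obtain ⟨dec, hdec, hd⟩ := nameCoding_natCantorInfo_rep.exists_dec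
  have hr := computable_readInput hdec
  let g : List ℕ → ℕ := fun σ =>
    if σ.length % 2 = 0 then g₁ (σ.take (σ.length / 2)) else g₂ (σ.take (σ.length / 2))
  have hg : Computable g := by fun_prop
  have hpair : ∀ p, prefixFun g p = pair (prefixFun g₁ p) (prefixFun g₂ p) := fun p => by
    funext n
    simp only [prefixFun, g, pair, length_initSeg, take_initSeg,
      min_eq_left (Nat.div_le_self n 2)]
  refine wReducible_iff.2 ⟨_, _, computableBaire_prefixFun hg,
    computableBaire_limitFun (θ := fun σ => if σ.length < 2 then [] else out (readInput dec σ))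
      (by fun_prop), fun p x hx hdom => ?_⟩
  obtain ⟨l1, l2, h⟩ := h p x hx hdom
  have m1 := l1
  obtain ⟨n, hn⟩ := m1
  obtain ⟨y, hy⟩ := l2.nonempty
  rw [← hn₁] at l1 hn
  rw [← hn₂] at l2 hy
  refine ⟨_, Part.mem_some _, (closedOfName (prefixFun g₁ p), closedOfName (prefixFun g₂ p)),
    mem_rep_prod.2 ?_, ⟨(n, y), ⟨l1, hn⟩, l2, hy⟩, ?_⟩
  · rw [hpair, unpairFst_pair, unpairSnd_pair]
    exact ⟨Part.mem_some _, Part.mem_some _⟩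
  · rintro t a ht ⟨⟨-, ha₁⟩, -, ha₂⟩
    obtain ⟨q, hq, hy⟩ := h a.1 (by rw [← hn₁]; exact ha₁) a.2 (by rw [← hn₂]; exact ha₂)
    exact ⟨q, (approx_readInput (ρ := prodInfo natInfo cantorInfo) (hd a t ht) hq).mem_limitFun, hy⟩

theorem tendsto_div_two : Tendsto (fun s : ℕ => s / 2) atTop atTop :=
  Nat.tendsto_div_const_atTop two_ne_zero

theorem parallelSolvable_CN_prod_PCCantor :
    ParallelSolvable natInfo Set.Nonempty cantorInfo CantorLarge (CN.prod PCCantor) := by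
  rw [CN_eq, PCCantor_eq]
  obtain ⟨hit₁, hh₁, hz₁, hm₁, hb₁⟩ := ballCoding_natInfo.exists_hit
  obtain ⟨hit₂, hh₂, hz₂, hm₂, hb₂⟩ := ballCoding_cantorInfo.exists_hit
  obtain ⟨enc, henc, he⟩ := nameCoding_natCantorInfo_rep.exists_enc
  have ha₁ := computable_avoids hh₁
  have ha₂ := computable_avoids hh₂
  refine ⟨fun a => avoids hit₁ (evens a.1, a.2), fun a => avoids hit₂ (odds a.1, a.2),
    fun a => enc (a.1.length, a.2), by fun_prop, by fun_prop, by fun_prop, ?_⟩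
  rintro p ⟨A, B⟩ hx ⟨⟨n₀, y₀⟩, ⟨l1, -⟩, l2, -⟩
  obtain ⟨hA, hB⟩ := mem_rep_prod.1 hx
  obtain rfl : A = closedOfName (unpairFst p) := Part.mem_some_iff.1 hA
  obtain rfl : B = closedOfName (unpairSnd p) := Part.mem_some_iff.1 hB
  have hev : Approx (fun s => evens (initSeg p s)) (unpairFst p) := by
    simpa only [evens_initSeg] using approx_initSeg_comp (unpairFst p) tendsto_div_two
  have hod : Approx (fun s => odds (initSeg p s)) (unpairSnd p) := by
    simpa only [odds_initSeg] using approx_initSeg_comp (unpairSnd p) tendsto_div_two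
  have k₁ := mem_closedOfName_iff_avoids hz₁ hm₁ hb₁ hev
  have k₂ := mem_closedOfName_iff_avoids hz₂ hm₂ hb₂ hod
  have s₁ : ((closedOfName (unpairFst p) : Closeds ℕ) : Set ℕ) =
    survivors natInfo (fun a => avoids hit₁ (evens a.1, a.2)) p := Set.ext k₁
  have s₂ : ((closedOfName (unpairSnd p) : Closeds Cantor) : Set Cantor) =
    survivors cantorInfo (fun a => avoids hit₂ (odds a.1, a.2)) p := Set.ext k₂
  rw [← s₁, ← s₂]
  refine ⟨l1, l2, fun n hn y hy => ?_⟩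
  obtain ⟨t, ht, hte⟩ := he (n, y)
  simp only [length_initSeg]
  exact ⟨t, hte, (n, y), ht, ⟨l1, hn⟩, l2, hy⟩

end Characterizations

/-! ### Products in reverse order and universe lifts -/

section Auxiliary

theorem computableBaire_id : ComputableBaire fun p => Part.some p :=
  computableBaire_of_approx (θ := fun σ => σ) (by fun_prop) fun p q hq => by
    obtain rfl := Part.mem_some_iff.1 hq
    exact approx_initSeg q

theorem computableBaire_unpairSnd : ComputableBaire fun p => Part.some (unpairSnd p) :=
  computableBaire_of_approx computable_odds fun p q hq => by
    obtain rfl := Part.mem_some_iff.1 hq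
    simpa only [odds_initSeg] using approx_initSeg_comp (unpairSnd p) tendsto_div_two

theorem wReducible_refl {X Y : Type*} [Represented X] [Represented Y] (f : MultiFun X Y) :
    WReducible f f := by
  refine ⟨_, _, computableBaire_id, computableBaire_unpairSnd, fun G hG p x hx hd => ?_⟩
  obtain ⟨q, hq, hy⟩ := hG p x hx hd
  refine ⟨q, Part.mem_bind_iff.2 ⟨p, Part.mem_some _, Part.mem_bind_iff.2 ⟨q, hq, ?_⟩⟩, hy⟩
  rw [unpairSnd_pair]
  exact Part.mem_some _

theorem computableBaire_swap :
    ComputableBaire fun p => Part.some (pair (unpairSnd p) (unpairFst p)) :=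
  computableBaire_of_approx (θ := fun σ => interleave (odds σ) (evens σ)) (by fun_prop)
    fun p q hq => by
      obtain rfl := Part.mem_some_iff.1 hq
      simp only [odds_initSeg, evens_initSeg]
      exact (approx_initSeg_comp _ tendsto_div_two).interleave
        (approx_initSeg_comp _ tendsto_div_two)

theorem mem_rep_swap {X : Type u} {Y : Type v} [Represented X] [Represented Y] {a : X × Y}
    {t : Baire} (h : a ∈ Represented.δ (X := X × Y) t) :
    a.swap ∈ Represented.δ (X := Y × X) (pair (unpairSnd t) (unpairFst t)) := by
  rw [mem_rep_prod] at h ⊢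
  rw [unpairFst_pair, unpairSnd_pair]
  exact h.symm

theorem swReducible_prod_comm {X Y Z W : Type*} [Represented X] [Represented Y] [Represented Z]
    [Represented W] (f : MultiFun X Y) (g : MultiFun Z W) :
    SWReducible (f.prod g) (g.prod f) := by
  refine ⟨_, _, computableBaire_swap, computableBaire_swap, ?_⟩
  rintro G hG p ⟨x, z⟩ hx ⟨⟨y, w⟩, hy, hw⟩
  obtain ⟨t, ht, b, hb, hbg⟩ := hG _ _ (mem_rep_swap hx) ⟨(w, y), hw, hy⟩
  refine ⟨_, Part.mem_bind_iff.2 ⟨_, Part.mem_some _, Part.mem_bind_iff.2 ⟨t, ht, Part.mem_some _⟩⟩,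
    b.swap, mem_rep_swap hb, hbg.2, hbg.1⟩

/-- The representation of a lifted space. -/
@[reducible]
def representedULift (X : Type u) [Represented X] : Represented (ULift.{w} X) where
  δ := fun p => (Represented.δ (X := X) p).map ULift.up
  surj := fun x => by
    obtain ⟨p, hp⟩ := Represented.surj x.down
    exact ⟨p, (Part.mem_map_iff _).2 ⟨x.down, hp, rfl⟩⟩

/-- A multi-valued function on lifted spaces. -/
def liftFun {X : Type u} {Y : Type v} (f : MultiFun X Y) : MultiFun (ULift.{w} X) (ULift.{w} Y) :=
  fun x => {y | y.down ∈ f x.down}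

variable {X : Type u} {Y : Type v} [Represented X] [Represented Y]

attribute [local instance] representedULift

theorem mem_rep_uLift {x : ULift.{w} X} {p : Baire} :
    x ∈ Represented.δ (X := ULift.{w} X) p ↔ x.down ∈ Represented.δ (X := X) p := by
  change x ∈ (Represented.δ (X := X) p).map ULift.up ↔ _
  rw [Part.mem_map_iff]
  constructor
  · rintro ⟨a, ha, rfl⟩
    exact ha
  · exact fun h => ⟨x.down, h, rfl⟩

theorem wEquiv_liftFun (f : MultiFun X Y) : WEquiv f (liftFun.{u, v, w} f) := by
  refine ⟨wReducible_iff.2 ⟨_, _, computableBaire_id, computableBaire_unpairSnd, ?_⟩,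
    wReducible_iff.2 ⟨_, _, computableBaire_id, computableBaire_unpairSnd, ?_⟩⟩
  · rintro p x hx ⟨y, hy⟩
    refine ⟨p, Part.mem_some _, ⟨x⟩, mem_rep_uLift.2 hx, ⟨⟨y⟩, hy⟩, fun t b ht hb => ?_⟩
    refine ⟨_, Part.mem_some _, b.down, ?_, hb⟩
    rw [unpairSnd_pair]
    exact mem_rep_uLift.1 ht
  · rintro p x hx ⟨y, hy⟩
    refine ⟨p, Part.mem_some _, x.down, mem_rep_uLift.1 hx, ⟨y.down, hy⟩, fun t b ht hb => ?_⟩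
    refine ⟨_, Part.mem_some _, ⟨b⟩, ?_, hb⟩
    rw [unpairSnd_pair]
    exact mem_rep_uLift.2 ht

theorem ParallelSolvable.liftFun {R₁ R₂ W₁ W₂ : Type} [Primcodable W₁] [Primcodable W₂]
    {ρ₁ : R₁ → ℕ → W₁} {large₁ : Set R₁ → Prop} {ρ₂ : R₂ → ℕ → W₂}
    {large₂ : Set R₂ → Prop} {f : MultiFun X Y} (h : ParallelSolvable ρ₁ large₁ ρ₂ large₂ f) :
    ParallelSolvable ρ₁ large₁ ρ₂ large₂ (Weihrauch.liftFun.{u, v, w} f) := by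
  obtain ⟨alive₁, alive₂, out, h1, h2, ho, h⟩ := h
  refine ⟨alive₁, alive₂, out, h1, h2, ho, ?_⟩
  rintro p x hx ⟨y, hy⟩
  obtain ⟨l1, l2, h⟩ := h p x.down (mem_rep_uLift.1 hx) ⟨y.down, hy⟩
  refine ⟨l1, l2, fun r₁ hr₁ r₂ hr₂ => ?_⟩
  obtain ⟨q, hq, y, hy, hyx⟩ := h r₁ hr₁ r₂ hr₂
  exact ⟨q, hq, ⟨y⟩, mem_rep_uLift.2 hy, hyx⟩

end Auxiliary

section Main

theorem isCompositionalProduct_PCCantor_CN :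
    IsCompositionalProduct.{u} PCCantor CN (CN.prod PCCantor) := by
  refine ⟨?_, fun X Y Z _ _ _ f₀ g₀ hf hg => ?_⟩
  · let _ := representedULift.{0, u} (Closeds ℕ × Closeds Cantor)
    let _ := representedULift.{0, u} (ℕ × Cantor)
    obtain ⟨Z, hZ, g, h, hg, hh, heq⟩ := ParallelSolvable.exists_comp.{u, u, u}
      nameCoding_natInfo truncatable_cantorInfo (fun _ h => h)
      (ParallelSolvable.liftFun.{0, 0, u} parallelSolvable_CN_prod_PCCantor)
    refine ⟨_, Z, _, inferInstance, hZ, inferInstance, g, h, wReducible_PCCantor_iff.2 hg,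
      wReducible_CN_iff.2 hh, ?_⟩
    rw [← heq]
    exact wEquiv_liftFun _
  · exact (Solvable.comp_cantor_nat (wReducible_PCCantor_iff.1 hf)
      (wReducible_CN_iff.1 hg)).parallelSolvable.wReducible

theorem isCompositionalProduct_CN_PCCantor :
    IsCompositionalProduct.{u} CN PCCantor (CN.prod PCCantor) := by
  refine ⟨?_, fun X Y Z _ _ _ f₀ g₀ hf hg => ?_⟩
  · let _ := representedULift.{0, u} (Closeds ℕ × Closeds Cantor)
    let _ := representedULift.{0, u} (ℕ × Cantor)
    obtain ⟨Z, hZ, g, h, hg, hh, heq⟩ := ParallelSolvable.exists_comp.{u, u, u}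
      nameCoding_cantorInfo truncatable_natInfo (fun _ h => CantorLarge.nonempty h)
      (ParallelSolvable.liftFun.{0, 0, u} parallelSolvable_CN_prod_PCCantor).symm
    refine ⟨_, Z, _, inferInstance, hZ, inferInstance, g, h, wReducible_CN_iff.2 hg,
      wReducible_PCCantor_iff.2 hh, ?_⟩
    rw [← heq]
    exact wEquiv_liftFun _
  · exact (Solvable.comp_nat_cantor (wReducible_CN_iff.1 hf)
      (wReducible_PCCantor_iff.1 hg)).parallelSolvable.wReducible

end Main

end Weihrauch

open Weihrauch
theorem corollary5p4 :
    -- `PC_{2^ℕ} × C_ℕ ≡_sW C_ℕ × PC_{2^ℕ}`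
    SWEquiv (PCCantor.prod CN) (CN.prod PCCantor) ∧
    -- `C_ℕ × PC_{2^ℕ} ≡_W PC_{2^ℕ} * C_ℕ`
    IsCompositionalProduct.{u} PCCantor CN (CN.prod PCCantor) ∧
    -- `C_ℕ × PC_{2^ℕ} ≡_W C_ℕ * PC_{2^ℕ}`
    IsCompositionalProduct.{u} CN PCCantor (CN.prod PCCantor) ∧
    -- `C_ℕ × PC_{2^ℕ} ≡_W PC_{ℕ × 2^ℕ}`
    WEquiv (CN.prod PCCantor) PCNatCantor ∧
    -- the characterization by compositions
    ∀ (X : Type u) (Y : Type v) [Represented X] [Represented Y] (f : MultiFun X Y),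
      List.TFAE [
        LasVegasFiniteMindChange f,
        ∃ (Z : Type w) (_ : Represented Z) (g : MultiFun Z Y) (h : MultiFun X Z),
          LasVegasComputable g ∧ FiniteMindChangeComputable h ∧ f = g.comp h,
        ∃ (Z : Type w) (_ : Represented Z) (g : MultiFun Z Y) (h : MultiFun X Z),
          FiniteMindChangeComputable g ∧ LasVegasComputable h ∧ f = g.comp h] := by
  refine ⟨⟨swReducible_prod_comm _ _, swReducible_prod_comm _ _⟩,
    isCompositionalProduct_PCCantor_CN, isCompositionalProduct_CN_PCCantor, ⟨?_, ?_⟩, ?_⟩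
  · exact wReducible_PCNatCantor_iff.2 parallelSolvable_CN_prod_PCCantor.solvable_natCantor
  · exact (wReducible_PCNatCantor_iff.1 (wReducible_refl _)).parallelSolvable.wReducible
  · intro X Y _ _ f
    tfae_have 1 → 2 := fun h => by
      obtain ⟨Z, hZ, g, h, hg, hh, heq⟩ := ParallelSolvable.exists_comp
        nameCoding_natInfo truncatable_cantorInfo (fun _ h => h)
        (lasVegasFiniteMindChange_iff.1 h).parallelSolvable
      exact ⟨Z, hZ, g, h, lasVegasComputable_iff.2 hg, finiteMindChangeComputable_iff.2 hh, heq⟩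
    tfae_have 1 → 3 := fun h => by
      obtain ⟨Z, hZ, g, h, hg, hh, heq⟩ := ParallelSolvable.exists_comp
        nameCoding_cantorInfo truncatable_natInfo (fun _ h => CantorLarge.nonempty h)
        (lasVegasFiniteMindChange_iff.1 h).parallelSolvable.symm
      exact ⟨Z, hZ, g, h, finiteMindChangeComputable_iff.2 hg, lasVegasComputable_iff.2 hh, heq⟩
    tfae_have 2 → 1 := by
      rintro ⟨Z, hZ, g, h, hg, hh, rfl⟩
      exact lasVegasFiniteMindChange_iff.2 (Solvable.comp_cantor_nat
        (lasVegasComputable_iff.1 hg) (finiteMindChangeComputable_iff.1 hh))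
    tfae_have 3 → 1 := by
      rintro ⟨Z, hZ, g, h, hg, hh, rfl⟩
      exact lasVegasFiniteMindChange_iff.2 (Solvable.comp_nat_cantor
        (finiteMindChangeComputable_iff.1 hg) (lasVegasComputable_iff.1 hh))
    tfae_finish
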